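/- **Setting.** Let $\mathcal H$ be a complex Hilbert space, $T>0$, and let $\psi\in\mathcal H$ be a unit vector. For $x\in\mathbb R$ and $t\in[0,T]$ let $H_{0x}(t)$ and $H_1(t)$ be bounded self-adjoint operators, let $L_j$ be finitely many bounded operators, and let $\gamma_j(t)\ge 0$ be rates. Assume that $H_{0x}(t)$ and $\partial_xH_{0x}(t)$ exist and are norm-continuous in $(x,t)$, and that $H_1$ and $\gamma_j$ are continuous on $[0,T]$. Put $$H^{\rm nh}_x(t)=H_{0x}(t)+H_1(t)-\tfrac{i}{2}\sum_j\gamma_j(t)L_j^\dagger L_j ,\qquad M_{\checkmark,x}(t)=\mathcal T\exp\Big(-i\int_0^tH_x^{\rm nh}(\tau)\,d\tau\Big),\qquad |\tilde\psi_x(t)\rangle=M_{\checkmark,x}(t)|\psi\rangle .$$ Let $\langle A\rangle=\langle\psi|A|\psi\rangle$, $E_{\checkmark,x}=M_{\checkmark,x}(T)^\dagger M_{\checkmark,x}(T)$, $F_{\checkmark,x}=i\,\partial_xM_{\checkmark,x}(T)^\dagger\, M_{\checkmark,x}(T)$, $p(\checkmark|x)=\langle E_{\checkmark,x}\rangle$,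 $\partial_x\theta_{\checkmark,x}=-\operatorname{Re}\langle F_{\checkmark,x}\rangle/\langle E_{\checkmark,x}\rangle$, and $$|\tilde\xi_{\checkmark,x}(t)\rangle=|\partial_x\tilde\psi_x(t)\rangle+i\,\partial_x\theta_{\checkmark,x}\,|\tilde\psi_x(t)\rangle ,\qquad t\in[0,T].$$ For a family of unit vectors $\phi_x$ the quantum Fisher information is $I(\phi_x)=4\,\|\partial_x\phi_x-\phi_x\langle\phi_x|\partial_x\phi_x\rangle\|^2$; the quantum Fisher information of a family of non-zero vectors means that of the normalized vectors. **Collision model.** For $N\ge1$ put $\Delta t=T/N$, $t_n=n\Delta t$, $M^{(n)}_{\checkmark,x}=\mathbb I-iH^{\rm nh}_x(t_n)\Delta t$ and $M_j^{(n)}=\sqrt{\gamma_j(t_n)\Delta t}\,L_j$. The measurement operators are the retained one, $M_{\checkmark,x}^{(N)}\cdots M_{\checkmark,x}^{(1)}$, and the discarded ones, $M_{jn,x}=M_j^{(n)}M_{\checkmark,x}^{(n-1)}\cdots M_{\checkmark,x}^{(1)}$ (first jump in step $n$, through channel $j$). Let $I^Q_N(x)$ be the quantum Fisher information of the joint system-environment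 state $\sum_\omega M_{\omega,x}|\psi\rangle\otimes|\pi_\omega\rangle$, where $\omega$ runs over all these outcomes and the $|\pi_\omega\rangle$ are orthonormal. Post-selected non-Hermitian sensing is called *lossless* at $x$, compared with the collision model in the continuous-time limit, if $$\lim_{N\to\infty}I^Q_N(x)=p(\checkmark|x)\,I\big(|\tilde\psi_x(T)\rangle\big).$$ **Theorem.** For every $x$, non-Hermitian sensing is lossless at $x$ if and only if (a) the post-selection probability is insensitive to the parameter: $\partial_x\langle E_{\checkmark,x}\rangle=0$; and (b) $L_j|\tilde\xi_{\checkmark,x}(t)\rangle=0$ for all $j$ and all $t\in[0,T]$ with $\gamma_j(t)>0$. If, for every $j$, the set of $t\in[0,T]$ with $\gamma_j(t)>0$ is dense in $[0,T]$ (for example if all rates are positive), then (b) may be replaced by: $L_j|\tilde\xi_{\checkmark,x}(t)\rangle=0$ for all $j$ and all $t\in[0,T]$. -/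

import Mathlib

open Filter Topology

noncomputable section

namespace NHSensing

variable {E : Type*} [NormedAddCommGroup E] [InnerProductSpace ℂ E]

/-- Quantum Fisher information at `x` of a family of unit vectors `φ`:
`4 ⟨∂ₓ^⊥ φ | ∂ₓ^⊥ φ⟩` with `∂ₓ^⊥ φ = ∂ₓ φ - φ ⟨φ | ∂ₓ φ⟩`. -/
def pureQFI (φ : ℝ → E) (x : ℝ) : ℝ :=
  4 * ‖deriv φ x - inner ℂ (φ x) (deriv φ x) • φ x‖ ^ 2

/-- The family of unit vectors obtained by normalizing a family of non-zero vectors. -/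
def normalized (φ : ℝ → E) (x : ℝ) : E := ((‖φ x‖⁻¹ : ℝ) : ℂ) • φ x

/-- Expectation value `⟨ψ | A | ψ⟩`. -/
def expect (ψ : E) (A : E →L[ℂ] E) : ℂ := inner ℂ ψ (A ψ)

/-- The terms of the Dyson series of `𝒯 exp (-i ∫₀ᵗ K)`:
`D₀ = 1`, `Dₙ₊₁(t) = ∫₀ᵗ (-i K(s)) Dₙ(s) ds`. -/
def dysonTerm (K : ℝ → E →L[ℂ] E) : ℕ → ℝ → E →L[ℂ] E
  | 0, _ => 1
  | n + 1, t => ∫ s in (0 : ℝ)..t, (-Complex.I) • (K s * dysonTerm K n s)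

/-- The time-ordered exponential `𝒯 exp (-i ∫₀ᵗ K(s) ds)`, as its Dyson series. -/
def timeOrderedExp (K : ℝ → E →L[ℂ] E) (t : ℝ) : E →L[ℂ] E :=
  ∑' n : ℕ, dysonTerm K n t

/-- The data of post-selected non-Hermitian sensing on the Hilbert space `E`, with jump
channels indexed by `J`: estimation Hamiltonian `H₀ x t`, control Hamiltonian `H₁ t`,
rates `γ j t` and jump operators `L j`. -/
structure Model (E : Type*) [NormedAddCommGroup E] [InnerProductSpace ℂ E] (J : Type*) where
  H₀ : ℝ → ℝ → E →L[ℂ] E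
  H₁ : ℝ → E →L[ℂ] E
  γ : J → ℝ → ℝ
  L : J → E →L[ℂ] E

namespace Model

variable [CompleteSpace E] {J : Type*} [Fintype J] (S : Model E J)

/-- The non-Hermitian Hamiltonian
`Hⁿʰ_x(t) = H₀ₓ(t) + H₁(t) - (i/2) ∑ⱼ γⱼ(t) Lⱼ† Lⱼ`. -/
def Hnh (x t : ℝ) : E →L[ℂ] E :=
  S.H₀ x t + S.H₁ t -
    (Complex.I / 2) • ∑ j, (S.γ j t : ℂ) • (ContinuousLinearMap.adjoint (S.L j) * S.L j)

/-! ### The discrete collision model with `N` steps of length `T / N` -/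

/-- No-jump operator of a step at time `t`: `1 - i Hⁿʰ_x(t) Δt`. -/
def stepCheck (x t Δt : ℝ) : E →L[ℂ] E :=
  1 - (Complex.I * (Δt : ℂ)) • S.Hnh x t

/-- Jump operator of channel `j` in a step at time `t`: `√(γⱼ(t) Δt) Lⱼ`. -/
def stepJump (j : J) (t Δt : ℝ) : E →L[ℂ] E :=
  (Real.sqrt (S.γ j t * Δt) : ℂ) • S.L j

/-- Product of the first `n` no-jump operators, later steps on the left;
the step number `m = 1, 2, …` is taken at time `m Δt`. -/
def prodCheck (x Δt : ℝ) : ℕ → E →L[ℂ] E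
  | 0 => 1
  | n + 1 => S.stepCheck x ((n + 1 : ℕ) * Δt) Δt * prodCheck x Δt n

/-- Measurement operators of the collision model with `N` steps. The outcome `none` is the
retained one (no jump in any step); the outcome `some (n, j)`, with `n = 0, …, N - 1`, is
the discarded one in which the first jump happens in step `n + 1`, through channel `j`. -/
def measOp (T : ℝ) (N : ℕ) (x : ℝ) : Option (Fin N × J) → E →L[ℂ] E
  | none => S.prodCheck x (T / N) N
  | some (n, j) =>
      S.stepJump j (((n : ℕ) + 1 : ℕ) * (T / N)) (T / N) * S.prodCheck x (T / N) n

/-- Joint system-environment vector `∑_ω (M_ω ψ) ⊗ |π_ω⟩` of the collision model; since the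
`|π_ω⟩` are orthonormal, it lives in the Hilbert sum of copies of `E` over the outcomes. -/
def jointVec (T : ℝ) (N : ℕ) (ψ : E) (x : ℝ) : PiLp 2 (fun _ : Option (Fin N × J) => E) :=
  WithLp.toLp 2 (fun ω => S.measOp T N x ω ψ)

/-- Quantum Fisher information of the joint system-environment state of the `N`-step
collision model. (The steps are norm-preserving only up to `O(Δt²)`, so the vector is
normalized first.) -/
def collisionQFI (T : ℝ) (N : ℕ) (ψ : E) (x : ℝ) : ℝ :=
  pureQFI (normalized (S.jointVec T N ψ)) x

/-! ### Continuous-time non-Hermitian evolution -/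

/-- `M_✓(t) = 𝒯 exp (-i ∫₀ᵗ Hⁿʰ_x)`. -/
def Mcheck (x t : ℝ) : E →L[ℂ] E := timeOrderedExp (S.Hnh x) t

/-- The unnormalized post-selected state `ψ̃(t) = M_✓(t) ψ`. -/
def psiTilde (t : ℝ) (ψ : E) (x : ℝ) : E := S.Mcheck x t ψ

/-- `E_✓ = M_✓† M_✓` at time `T`. -/
def Echeck (T x : ℝ) : E →L[ℂ] E :=
  ContinuousLinearMap.adjoint (S.Mcheck x T) * S.Mcheck x T

/-- `F_✓ = i (∂ₓ M_✓†) M_✓` at time `T`. -/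
def Fcheck (T x : ℝ) : E →L[ℂ] E :=
  Complex.I •
    (deriv (fun y => ContinuousLinearMap.adjoint (S.Mcheck y T)) x * S.Mcheck x T)

/-- The post-selection probability `p(✓|x) = ⟨E_✓⟩`. -/
def prob (T : ℝ) (ψ : E) (x : ℝ) : ℝ := (expect ψ (S.Echeck T x)).re

/-- `∂ₓ θ_✓ = - Re ⟨F_✓⟩ / ⟨E_✓⟩`. -/
def dTheta (T : ℝ) (ψ : E) (x : ℝ) : ℝ :=
  -(expect ψ (S.Fcheck T x)).re / S.prob T ψ x

/-- The gauge-corrected derivative `ξ̃(t) = ∂ₓ ψ̃(t) + i ∂ₓθ_✓ ψ̃(t)`, where `∂ₓθ_✓` is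
computed at the final time `T`. -/
def xiTilde (T : ℝ) (ψ : E) (x t : ℝ) : E :=
  deriv (S.psiTilde t ψ) x + (Complex.I * (S.dTheta T ψ x : ℂ)) • S.psiTilde t ψ x

/-- Average quantum Fisher information `p(✓|x) I(σ_{x|✓})` of the post-selected state
`σ_{x|✓} = |ψ̃(T)⟩⟨ψ̃(T)| / p(✓|x)`. -/
def postselectedQFI (T : ℝ) (ψ : E) (x : ℝ) : ℝ :=
  S.prob T ψ x * pureQFI (normalized (S.psiTilde T ψ)) x

/-- Non-Hermitian sensing for the time `T` is lossless at `x`: in the continuous-time limit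
(`N → ∞` steps of length `T / N`), the quantum Fisher information of the joint
system-environment state of the collision model is the average quantum Fisher information
of the post-selected state. -/
def Lossless (T : ℝ) (ψ : E) (x : ℝ) : Prop :=
  Tendsto (fun N : ℕ => S.collisionQFI T N ψ x) atTop (𝓝 (S.postselectedQFI T ψ x))

end Model

end NHSensing

end

/-!
Let `u(t) = ψ̃(t)`, `v(t) = ∂ₓψ̃(t)` and let `p = ‖u(T)‖²` be the post-selection probability.
The no-jump products of the collision model, applied to `ψ`, together with their `x`-derivatives,
are an Euler scheme for `u' = G u`, `v' = G' u + G v`, where `G = -i Hⁿʰ` (`G'` is its derivative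
in `x`). The scheme converges uniformly on the grid (`euler_scheme_converges`), and the sums over
the discarded outcomes are Riemann sums along it (`tendsto_riemann_sum`). Hence, with
`⟨a, b⟩_J = ∑ⱼ γⱼ ⟨Lⱼ a, Lⱼ b⟩`, the joint Fisher information tends to
`4 (‖v(T)‖² + ∫ ⟨v, v⟩_J - |⟨u(T), v(T)⟩ + ∫ ⟨u, v⟩_J|²)` (`tendsto_collisionQFI`).
Conservation of probability, `‖u(T)‖² + ∫ ⟨u, u⟩_J = 1`, and its `x`-derivative make the last
overlap purely imaginary.

The post-selected term is `4 (‖v(T)‖² - |⟨u(T), v(T)⟩|² / p)`. Write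
`⟨u(T), v(T)⟩ = r + i b` and let `q(s) = ∫ ⟨v + i s u, v + i s u⟩_J ≥ 0`, a quadratic polynomial
in the real number `s` with leading coefficient `1 - p`. Then `∂ₓθ = -b / p`, and the difference of
the two informations is `4 (q(∂ₓθ) - Z² + r² / p)` with `Z = q'(∂ₓθ) / 2`. Nonnegativity of `q` at
`∂ₓθ - Z` gives `(1 + p) Z² ≤ q(∂ₓθ)`. As `p > 0`, the difference is nonnegative and vanishes
exactly when `r = 0` and `q(∂ₓθ) = 0` (`fisher_gap_eq_zero_iff`). These are the two conditions:
`2 r` is the derivative of `p`, and `q(∂ₓθ)` integrates the continuous nonnegative function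
`∑ⱼ γⱼ ‖Lⱼ ξ̃‖²`.

That `∂ₓψ̃` exists and solves the variational equation is proved by summing Picard series
(`exists_hasSum_volterraTerm`), which identify the Dyson series, and by Grönwall's lemma
(`hasDerivAt_parameter_of_linear_ode`).
-/

open Filter Topology

namespace NHSensing

open Set MeasureTheory intervalIntegral

/-! ### Linear differential equations in a Banach algebra -/

section LinearODE

open scoped Nat

variable {A : Type*} [NormedRing A] [NormedAlgebra ℝ A]

/-- The Picard iterates of the Volterra equation `G t = g t + ∫₀ᵗ K s * G s`, as the terms
of a series: `g`, `∫ K g`, `∫ K ∫ K g`, …. -/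
noncomputable def volterraTerm (K g : ℝ → A) : ℕ → ℝ → A
  | 0, t => g t
  | n + 1, t => ∫ s in (0 : ℝ)..t, K s * volterraTerm K g n s

theorem continuous_volterraTerm {K g : ℝ → A} (hK : Continuous K) (hg : Continuous g) (n : ℕ) :
    Continuous (volterraTerm K g n) := by
  induction n with
  | zero => exact hg
  | succ n ih =>
    exact continuous_primitive (fun a b => (hK.mul ih).intervalIntegrable a b) 0

theorem norm_volterraTerm_le {K g : ℝ → A} (hK : Continuous K) (hg : Continuous g)
    {T B C : ℝ} (hC : ∀ t ∈ Icc 0 T, ‖K t‖ ≤ C) (hB : ∀ t ∈ Icc 0 T, ‖g t‖ ≤ B)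
    (n : ℕ) {t : ℝ} (ht : t ∈ Icc 0 T) :
    ‖volterraTerm K g n t‖ ≤ B * (C ^ n * t ^ n / n !) := by
  induction n generalizing t with
  | zero => simpa [volterraTerm] using hB t ht
  | succ n ih =>
    have h0 : (0 : ℝ) ∈ Icc 0 T := ⟨le_rfl, ht.1.trans ht.2⟩
    have hC0 : 0 ≤ C := (norm_nonneg _).trans (hC 0 h0)
    calc ‖volterraTerm K g (n + 1) t‖
        ≤ ∫ s in (0 : ℝ)..t, ‖K s * volterraTerm K g n s‖ :=
          norm_integral_le_integral_norm ht.1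
      _ ≤ ∫ s in (0 : ℝ)..t, C * (B * (C ^ n * s ^ n / n !)) := by
          refine integral_mono_on ht.1
            ((hK.mul (continuous_volterraTerm hK hg n)).norm.intervalIntegrable _ _)
            (Continuous.intervalIntegrable (by fun_prop) _ _) fun s hs => ?_
          have hs' : s ∈ Icc 0 T := ⟨hs.1, hs.2.trans ht.2⟩
          exact (norm_mul_le _ _).trans
            (mul_le_mul (hC s hs') (ih hs') (norm_nonneg _) hC0)
      _ = B * (C ^ (n + 1) * t ^ (n + 1) / (n + 1)!) := by
          have : ∀ s : ℝ, C * (B * (C ^ n * s ^ n / n !)) = (C * B * C ^ n / n !) * s ^ n :=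
            fun s => by ring
          simp only [this, intervalIntegral.integral_const_mul, integral_pow]
          rw [Nat.factorial_succ]
          have hn : (n ! : ℝ) ≠ 0 := by positivity
          push_cast
          field_simp
          ring

/-- The Picard series converges on `[0, T]`, and its sum solves `G' = g' + K G`, `G 0 = g 0`
there. -/
theorem exists_hasSum_volterraTerm [CompleteSpace A] {K g g' : ℝ → A} (hK : Continuous K)
    (hg : ∀ t, HasDerivAt g (g' t) t) {T : ℝ} (hT : 0 ≤ T) :
    ∃ G : ℝ → A, Continuous G ∧ (∀ t ∈ Icc 0 T, HasSum (fun n => volterraTerm K g n t) (G t)) ∧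
      G 0 = g 0 ∧ ∀ t ∈ Icc 0 T, HasDerivAt G (g' t + K t * G t) t := by
  have hgc : Continuous g := continuous_iff_continuousAt.2 fun t => (hg t).continuousAt
  obtain ⟨C, hC⟩ := isCompact_Icc.exists_bound_of_continuousOn (s := Icc 0 T) hK.continuousOn
  obtain ⟨B, hB⟩ := isCompact_Icc.exists_bound_of_continuousOn (s := Icc 0 T) hgc.continuousOn
  have h0 : (0 : ℝ) ∈ Icc 0 T := ⟨le_rfl, hT⟩
  have hC0 : 0 ≤ C := (norm_nonneg _).trans (hC 0 h0)
  have hB0 : 0 ≤ B := (norm_nonneg _).trans (hB 0 h0)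
  set bd : ℕ → ℝ := fun n => B * (C ^ n * T ^ n / n !) with hbd
  have hbds : Summable bd := by
    refine Summable.mul_left B ?_
    simpa [mul_pow] using Real.summable_pow_div_factorial (C * T)
  have hterm : ∀ n, ∀ t ∈ Icc 0 T, ‖volterraTerm K g n t‖ ≤ bd n := fun n t ht =>
    (norm_volterraTerm_le hK hgc hC hB n ht).trans <| by
      have := pow_le_pow_left₀ ht.1 ht.2 n
      simp only [hbd]
      gcongr
  have hsum : ∀ t ∈ Icc 0 T, Summable fun n => volterraTerm K g n t := fun t ht =>
    Summable.of_norm_bounded hbds fun n => hterm n t ht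
  set S : ℝ → A := fun t => ∑' n, volterraTerm K g n t with hS
  have hScont : ContinuousOn S (Icc 0 T) :=
    continuousOn_tsum (fun n => (continuous_volterraTerm hK hgc n).continuousOn) hbds hterm
  -- Extending the sum continuously to the line and integrating once more gives a function that is
  -- differentiable at the end points too.
  set S' : ℝ → A := IccExtend hT ((Icc 0 T).domRestrict S) with hS'
  have hS'c : Continuous S' := hScont.domRestrict.Icc_extend'
  have hS'eq : ∀ t ∈ Icc 0 T, S' t = S t := fun t ht => by
    rw [hS', IccExtend_of_mem hT _ ht]; rfl
  set G : ℝ → A := fun t => g t + ∫ s in (0 : ℝ)..t, K s * S' s with hG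
  have hKS : Continuous fun s => K s * S' s := hK.mul hS'c
  have hGd : ∀ t, HasDerivAt G (g' t + K t * S' t) t := fun t =>
    (hg t).add (hKS.integral_hasStrictDerivAt 0 t).hasDerivAt
  have hGS : ∀ t ∈ Icc 0 T, G t = S t := fun t ht => by
    have hsub : ∀ s ∈ uIoc 0 t, s ∈ Icc 0 T := fun s hs => by
      rw [uIoc_of_le ht.1] at hs
      exact ⟨hs.1.le, hs.2.trans ht.2⟩
    have h1 : HasSum (fun n => volterraTerm K g (n + 1) t) (∫ s in (0 : ℝ)..t, K s * S' s) := by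
      refine intervalIntegral.hasSum_integral_of_dominated_convergence
        (fun n _ => C * bd n) (fun n => ?_) (fun n => ?_) ?_ ?_ ?_
      · exact (hK.mul (continuous_volterraTerm hK hgc n)).aestronglyMeasurable
      · refine Eventually.of_forall fun s hs => (norm_mul_le _ _).trans ?_
        exact mul_le_mul (hC s (hsub s hs)) (hterm n s (hsub s hs)) (norm_nonneg _) hC0
      · exact Eventually.of_forall fun s _ => hbds.mul_left C
      · exact continuous_const.intervalIntegrable _ _
      · refine Eventually.of_forall fun s hs => ?_
        rw [hS'eq s (hsub s hs)]
        exact (hsum s (hsub s hs)).hasSum.mul_left (K s)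
    rw [hS]
    simp only
    rw [(hsum t ht).tsum_eq_zero_add, h1.tsum_eq]
    rfl
  refine ⟨G, continuous_iff_continuousAt.2 fun t => (hGd t).continuousAt, fun t ht => ?_, ?_,
    fun t ht => ?_⟩
  · rw [hGS t ht]
    exact (hsum t ht).hasSum
  · simp [hG]
  · rw [hGS t ht, ← hS'eq t ht]
    exact hGd t

/-- Continuity at `x` in the first variable, uniformly over the compact range of the second. -/
theorem eventually_norm_sub_le_of_continuous {F : Type*} [NormedAddCommGroup F]
    {k : ℝ × ℝ → F} (hk : Continuous k) (x T : ℝ) {ε : ℝ} (hε : 0 < ε) :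
    ∀ᶠ y in 𝓝 x, ∀ t ∈ Icc 0 T, ‖k (y, t) - k (x, t)‖ ≤ ε := by
  refine isCompact_Icc.eventually_forall_of_forall_eventually fun t _ => ?_
  have hc : Continuous fun z : ℝ × ℝ => ‖k (z.1, z.2) - k (x, z.2)‖ := by fun_prop
  have := hc.tendsto (x, t)
  simp only [sub_self, norm_zero] at this
  exact (this.eventually_lt_const hε).mono fun z hz => hz.le

/-- Differentiable dependence on a parameter: if `∂ₜ M y = K y * M y` with `M y 0` independent
of `y`, then `∂_y M` at `x` is the solution of the variational equation
`Q' = K' M + K Q`, `Q 0 = 0`. The remainder of the first-order expansion satisfies a linear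
differential inequality, so Grönwall's lemma applies. -/
theorem hasDerivAt_parameter_of_linear_ode {K K' : ℝ → ℝ → A}
    (hKc : Continuous fun z : ℝ × ℝ => K z.1 z.2)
    (hK'c : Continuous fun z : ℝ × ℝ => K' z.1 z.2)
    (hK' : ∀ y t, HasDerivAt (fun y => K y t) (K' y t) y)
    {M : ℝ → ℝ → A} {T : ℝ}
    (hM : ∀ y, ∀ t ∈ Icc 0 T, HasDerivAt (M y) (K y t * M y t) t)
    {x : ℝ} (hM0 : ∀ y, M y 0 = M x 0) {Q : ℝ → A} (hQ0 : Q 0 = 0)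
    (hQ : ∀ t ∈ Icc 0 T, HasDerivAt Q (K' x t * M x t + K x t * Q t) t)
    {t : ℝ} (ht : t ∈ Icc 0 T) : HasDerivAt (fun y => M y t) (Q t) x := by
  obtain ⟨C, hC⟩ := isCompact_Icc.exists_bound_of_continuousOn (s := Icc 0 T)
    (f := K x) (by fun_prop)
  obtain ⟨BM, hBM⟩ := isCompact_Icc.exists_bound_of_continuousOn (s := Icc 0 T)
    (f := M x) (fun s hs => (hM x s hs).continuousAt.continuousWithinAt)
  obtain ⟨BQ, hBQ⟩ := isCompact_Icc.exists_bound_of_continuousOn (s := Icc 0 T)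
    (f := Q) (fun s hs => (hQ s hs).continuousAt.continuousWithinAt)
  have h0 : (0 : ℝ) ∈ Icc 0 T := ⟨le_rfl, ht.1.trans ht.2⟩
  have hC0 : 0 ≤ C := (norm_nonneg _).trans (hC 0 h0)
  have hBM0 : 0 ≤ BM := (norm_nonneg _).trans (hBM 0 h0)
  have hBQ0 : 0 ≤ BQ := (norm_nonneg _).trans (hBQ 0 h0)
  set D : ℝ := (BM + BQ + 1) * Real.exp ((C + 1) * t) with hD
  have hDpos : 0 < D := by positivity
  rw [hasDerivAt_iff_isLittleO, Asymptotics.isLittleO_iff]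
  intro c hc
  set ε : ℝ := c / D with hε
  have hεpos : 0 < ε := by positivity
  obtain ⟨δ, hδ, hball⟩ := Metric.eventually_nhds_iff_ball.1
    (((eventually_norm_sub_le_of_continuous hKc x T hεpos).and
      (eventually_norm_sub_le_of_continuous hKc x T one_pos)).and
      (eventually_norm_sub_le_of_continuous hK'c x T hεpos))
  filter_upwards [Metric.ball_mem_nhds x hδ] with y hy
  obtain ⟨⟨hy1, hy2⟩, -⟩ := hball y hy
  have hexp : ∀ s ∈ Icc 0 T, ‖K y s - K x s - (y - x) • K' x s‖ ≤ ε * ‖y - x‖ := by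
    intro s hs
    have := (convex_ball x δ).norm_image_sub_le_of_norm_hasDerivWithin_le
      (f := fun z => K z s - z • K' x s) (f' := fun z => K' z s - K' x s) (C := ε)
      (fun z _ => by
        have h := (hK' z s).sub ((hasDerivAt_id z).smul_const (K' x s))
        rw [one_smul] at h
        exact h.hasDerivWithinAt)
      (fun z hz => (hball z hz).2 s hs) (Metric.mem_ball_self hδ) hy
    have e : K y s - K x s - (y - x) • K' x s =
        K y s - y • K' x s - (K x s - x • K' x s) := by
      rw [sub_smul]
      abel
    rw [e]
    exact this
  -- The remainder of the first-order expansion in the parameter.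
  set R : ℝ → A := fun s => M y s - M x s - (y - x) • Q s with hR
  have hRd : ∀ s ∈ Icc 0 T, HasDerivAt R (K y s * M y s - K x s * M x s -
      (y - x) • (K' x s * M x s + K x s * Q s)) s := fun s hs =>
    ((hM y s hs).sub (hM x s hs)).sub ((hQ s hs).const_smul (y - x))
  have key := norm_le_gronwallBound_of_norm_deriv_right_le (f := R)
    (f' := fun s => K y s * M y s - K x s * M x s -
      (y - x) • (K' x s * M x s + K x s * Q s)) (δ := 0) (K := C + 1)
    (ε := ε * ‖y - x‖ * (BM + BQ)) (a := 0) (b := T)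
    (fun s hs => (hRd s hs).continuousAt.continuousWithinAt)
    (fun s hs => (hRd s ⟨hs.1, hs.2.le⟩).hasDerivWithinAt)
    (by simp [hR, hM0 y, hQ0]) (fun s hs' => by
      have hs : s ∈ Icc 0 T := ⟨hs'.1, hs'.2.le⟩
      have hdec : K y s * M y s - K x s * M x s - (y - x) • (K' x s * M x s + K x s * Q s)
          = K y s * R s + (K y s - K x s - (y - x) • K' x s) * M x s
            + (y - x) • ((K y s - K x s) * Q s) := by
        simp only [hR, mul_sub, sub_mul, smul_add, smul_sub, smul_mul_assoc, mul_smul_comm]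
        abel
      have hKy : ‖K y s‖ ≤ C + 1 := by
        have h1 := hy2 s hs
        have h2 := hC s hs
        have h3 := norm_add_le (K x s) (K y s - K x s)
        rw [add_sub_cancel] at h3
        linarith
      rw [hdec]
      refine (norm_add₃_le).trans ?_
      have e1 : ‖K y s * R s‖ ≤ (C + 1) * ‖R s‖ :=
        (norm_mul_le _ _).trans (by gcongr)
      have e2 : ‖(K y s - K x s - (y - x) • K' x s) * M x s‖ ≤ ε * ‖y - x‖ * BM :=
        (norm_mul_le _ _).trans (mul_le_mul (hexp s hs) (hBM s hs) (norm_nonneg _)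
          (by positivity))
      have e3 : ‖(y - x) • ((K y s - K x s) * Q s)‖ ≤ ‖y - x‖ * (ε * BQ) := by
        rw [norm_smul]
        gcongr
        exact (norm_mul_le _ _).trans (mul_le_mul (hy1 s hs) (hBQ s hs) (norm_nonneg _)
          hεpos.le)
      linarith) t ht
  have hC1 : C + 1 ≠ 0 := by positivity
  refine key.trans ?_
  rw [gronwallBound_of_K_ne_0 hC1, sub_zero]
  simp only [zero_mul, zero_add]
  have hexp1 : 0 ≤ Real.exp ((C + 1) * t) - 1 := by
    have : 0 ≤ (C + 1) * t := mul_nonneg (by positivity) ht.1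
    linarith [Real.add_one_le_exp ((C + 1) * t)]
  calc ε * ‖y - x‖ * (BM + BQ) / (C + 1) * (Real.exp ((C + 1) * t) - 1)
      ≤ ε * ‖y - x‖ * (BM + BQ) * (Real.exp ((C + 1) * t) - 1) := by
        gcongr
        exact div_le_self (by positivity) (by linarith)
    _ ≤ ε * ‖y - x‖ * (BM + BQ + 1) * Real.exp ((C + 1) * t) := by
        refine mul_le_mul ?_ (by linarith) hexp1 (by positivity)
        exact mul_le_mul_of_nonneg_left (by linarith) (by positivity)
    _ = ε * D * ‖y - x‖ := by rw [hD]; ring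
    _ = c * ‖y - x‖ := by rw [hε, div_mul_cancel₀ _ hDpos.ne']

end LinearODE

/-! ### Convergence of the Euler scheme and of Riemann sums along it -/

theorem grid_mem_Icc {T : ℝ} (hT : 0 ≤ T) {N n : ℕ} (hn : n ≤ N) :
    (n : ℝ) * (T / N) ∈ Icc 0 T := by
  rcases Nat.eq_zero_or_pos N with rfl | hN
  · simpa using hT
  have hN' : (0 : ℝ) < N := by exact_mod_cast hN
  have hn' : (n : ℝ) ≤ N := by exact_mod_cast hn
  refine ⟨by positivity, ?_⟩
  calc (n : ℝ) * (T / N) ≤ N * (T / N) := by gcongr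
    _ = T := by field_simp

theorem tendsto_const_div_natCast (T : ℝ) :
    Tendsto (fun N : ℕ => T / (N : ℝ)) atTop (𝓝 0) :=
  tendsto_const_nhds.div_atTop tendsto_natCast_atTop_atTop

/-- The Euler scheme with step `T / N`, whose vector field is evaluated at the right end of each
step, converges to the solution, uniformly on the grid. -/
theorem euler_scheme_converges {F : Type*} [NormedAddCommGroup F] [NormedSpace ℝ F]
    {f : F → ℝ → F} (hf : Continuous fun z : F × ℝ => f z.1 z.2)
    {T : ℝ} (hT : 0 < T) {C : ℝ} (hC : 0 ≤ C)
    (hLip : ∀ t ∈ Icc 0 T, ∀ a b, ‖f a t - f b t‖ ≤ C * ‖a - b‖) {y : ℝ → F}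
    (hy : ∀ t ∈ Icc 0 T, HasDerivAt y (f (y t) t) t) {Y : ℕ → ℕ → F} (hY0 : ∀ N, Y N 0 = y 0)
    (hY : ∀ N n : ℕ, n < N →
      Y N (n + 1) = Y N n + (T / N) • f (Y N n) ((n + 1 : ℕ) * (T / N)))
    {ε : ℝ} (hε : 0 < ε) :
    ∀ᶠ N : ℕ in atTop, ∀ n ≤ N, ‖Y N n - y (n * (T / N))‖ ≤ ε := by
  have hyc : ContinuousOn y (Icc 0 T) := fun t ht => (hy t ht).continuousAt.continuousWithinAt
  have hu : UniformContinuousOn (fun z : ℝ × ℝ => f (y z.1) z.2) (Icc 0 T ×ˢ Icc 0 T) := by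
    refine (isCompact_Icc.prod isCompact_Icc).uniformContinuousOn_of_continuous ?_
    exact hf.comp_continuousOn
      ((hyc.comp continuousOn_fst fun z hz => hz.1).prodMk continuousOn_snd)
  set η : ℝ := ε / (T * Real.exp (C * T)) with hη
  have hηpos : 0 < η := by positivity
  obtain ⟨δ, hδ, hu⟩ := Metric.uniformContinuousOn_iff.1 hu η hηpos
  filter_upwards [(tendsto_const_div_natCast T).eventually_lt_const hδ, eventually_gt_atTop 0]
    with N hNδ hN
  have hN' : (0 : ℝ) < N := by exact_mod_cast hN
  set τ : ℝ := T / N with hτ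
  have hτpos : 0 < τ := by positivity
  have hmem : ∀ n ≤ N, (n : ℝ) * τ ∈ Icc 0 T := fun n hn => grid_mem_Icc hT.le hn
  -- The local error is `η τ`: on one step the field varies by at most `η` along the solution.
  have hloc : ∀ n < N, ‖y ((n + 1 : ℕ) * τ) - y (n * τ)
      - τ • f (y (n * τ)) ((n + 1 : ℕ) * τ)‖ ≤ η * τ := by
    intro n hn
    have ha := hmem n hn.le
    have hb := hmem (n + 1) hn
    have hab : ((n + 1 : ℕ) : ℝ) * τ - n * τ = τ := by push_cast; ring
    have hsub : ∀ s ∈ Icc (n * τ) ((n + 1 : ℕ) * τ), s ∈ Icc 0 T := fun s hs =>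
      ⟨ha.1.trans hs.1, hs.2.trans hb.2⟩
    have hconv := convex_Icc (𝕜 := ℝ) ((n : ℝ) * τ) ((n + 1 : ℕ) * τ)
    have := hconv.norm_image_sub_le_of_norm_hasDerivWithin_le
      (f := fun s => y s - s • f (y (n * τ)) ((n + 1 : ℕ) * τ))
      (f' := fun s => f (y s) s - f (y (n * τ)) ((n + 1 : ℕ) * τ)) (C := η)
      (x := n * τ) (y := (n + 1 : ℕ) * τ)
      (fun s hs => by
        have h := (hy s (hsub s hs)).sub
          ((hasDerivAt_id s).smul_const (f (y (n * τ)) ((n + 1 : ℕ) * τ)))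
        rw [one_smul] at h
        exact h.hasDerivWithinAt)
      (fun s hs => by
        rw [← dist_eq_norm]
        refine (hu (s, s) ⟨hsub s hs, hsub s hs⟩ (n * τ, (n + 1 : ℕ) * τ) ⟨ha, hb⟩ ?_).le
        rw [Prod.dist_eq, max_lt_iff, Real.dist_eq, Real.dist_eq, abs_lt, abs_lt]
        obtain ⟨h1, h2⟩ := hs
        refine ⟨⟨?_, ?_⟩, ?_, ?_⟩ <;> simp only <;> linarith)
      ⟨le_rfl, by linarith⟩ ⟨by linarith, le_rfl⟩
    rw [hab, Real.norm_of_nonneg hτpos.le] at this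
    have e : y ((n + 1 : ℕ) * τ) - y (n * τ) - τ • f (y (n * τ)) ((n + 1 : ℕ) * τ)
        = y ((n + 1 : ℕ) * τ) - (((n + 1 : ℕ) : ℝ) * τ) • f (y (n * τ)) ((n + 1 : ℕ) * τ)
          - (y (n * τ) - ((n : ℝ) * τ) • f (y (n * τ)) ((n + 1 : ℕ) * τ)) := by
      have : τ • f (y (n * τ)) ((n + 1 : ℕ) * τ)
          = (((n + 1 : ℕ) : ℝ) * τ) • f (y (n * τ)) ((n + 1 : ℕ) * τ)
            - ((n : ℝ) * τ) • f (y (n * τ)) ((n + 1 : ℕ) * τ) := by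
        rw [← sub_smul, hab]
      rw [this]
      abel
    rw [e]
    exact this
  -- Discrete Grönwall: local errors accumulate with growth factor `1 + C τ ≤ exp (C τ)`.
  have herr : ∀ n ≤ N, ‖Y N n - y (n * τ)‖ ≤ η * (n * τ) * Real.exp (C * (n * τ)) := by
    intro n
    induction n with
    | zero => intro _; simp [hY0]
    | succ n ih =>
      intro hn
      have ih := ih (by omega)
      have e : Y N (n + 1) - y ((n + 1 : ℕ) * τ)
          = (Y N n - y (n * τ))
            + τ • (f (Y N n) ((n + 1 : ℕ) * τ) - f (y (n * τ)) ((n + 1 : ℕ) * τ))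
            - (y ((n + 1 : ℕ) * τ) - y (n * τ) - τ • f (y (n * τ)) ((n + 1 : ℕ) * τ)) := by
        rw [hY N n hn, smul_sub]
        abel
      have e2 : ‖τ • (f (Y N n) ((n + 1 : ℕ) * τ) - f (y (n * τ)) ((n + 1 : ℕ) * τ))‖
          ≤ τ * (C * ‖Y N n - y (n * τ)‖) := by
        rw [norm_smul, Real.norm_of_nonneg hτpos.le]
        exact mul_le_mul_of_nonneg_left (hLip _ (hmem _ hn) _ _) hτpos.le
      have h1 : ‖Y N (n + 1) - y ((n + 1 : ℕ) * τ)‖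
          ≤ (1 + C * τ) * ‖Y N n - y (n * τ)‖ + η * τ := by
        rw [e]
        refine (norm_sub_le _ _).trans ?_
        have := norm_add_le (Y N n - y (n * τ))
          (τ • (f (Y N n) ((n + 1 : ℕ) * τ) - f (y (n * τ)) ((n + 1 : ℕ) * τ)))
        linarith [hloc n hn]
      have h2 : 1 + C * τ ≤ Real.exp (C * τ) := by
        linarith [Real.add_one_le_exp (C * τ)]
      have h3 : Real.exp (C * ((n + 1 : ℕ) * τ)) = Real.exp (C * τ) * Real.exp (C * (n * τ)) := by
        rw [← Real.exp_add]
        congr 1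
        push_cast
        ring
      have h4 : 1 ≤ Real.exp (C * ((n + 1 : ℕ) * τ)) := Real.one_le_exp (by positivity)
      calc ‖Y N (n + 1) - y ((n + 1 : ℕ) * τ)‖
          ≤ Real.exp (C * τ) * (η * (n * τ) * Real.exp (C * (n * τ)))
            + η * τ * Real.exp (C * ((n + 1 : ℕ) * τ)) := by
            refine h1.trans (add_le_add ?_ (le_mul_of_one_le_right (by positivity) h4))
            exact mul_le_mul h2 ih (norm_nonneg _) (Real.exp_pos _).le
        _ = η * ((n + 1 : ℕ) * τ) * Real.exp (C * ((n + 1 : ℕ) * τ)) := by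
            rw [h3]
            push_cast
            ring
  intro n hn
  refine (herr n hn).trans ?_
  have h := (hmem n hn).2
  calc η * (n * τ) * Real.exp (C * (n * τ)) ≤ η * T * Real.exp (C * T) := by gcongr
    _ = ε := by rw [hη]; field_simp

/-- Riemann sums of a continuous function along grid points that approximate a continuous curve
uniformly converge to the integral along the curve. -/
theorem tendsto_riemann_sum {F G : Type*} [NormedAddCommGroup F] [NormedAddCommGroup G]
    [NormedSpace ℝ G] [CompleteSpace G] {f : F × ℝ → G} (hf : Continuous f) {T : ℝ} (hT : 0 < T) {y : ℝ → F}
    (hy : ContinuousOn y (Icc 0 T)) {Y : ℕ → ℕ → F}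
    (hY : ∀ ε > 0, ∀ᶠ N : ℕ in atTop, ∀ n ≤ N, ‖Y N n - y (n * (T / N))‖ ≤ ε) :
    Tendsto (fun N : ℕ => ∑ n ∈ Finset.range N, (T / N) • f (Y N n, (n + 1 : ℕ) * (T / N))) atTop
      (𝓝 (∫ s in (0 : ℝ)..T, f (y s, s))) := by
  have hcurve : ContinuousOn (fun s => (y s, s)) (Icc 0 T) := hy.prodMk continuousOn_id
  have hfc : ContinuousOn (fun s => f (y s, s)) (Icc 0 T) := hf.comp_continuousOn hcurve
  rw [Metric.tendsto_nhds]
  intro ε hε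
  set η : ℝ := ε / (2 * T) with hη
  have hηpos : 0 < η := by positivity
  obtain ⟨δ, hδ, hfδ⟩ := Metric.mem_uniformity_dist.1
    ((isCompact_Icc.image_of_continuousOn hcurve).uniformContinuousAt_of_continuousAt f
      (fun z _ => hf.continuousAt) (Metric.dist_mem_uniformity hηpos))
  obtain ⟨δ', hδ', hyδ⟩ := Metric.uniformContinuousOn_iff.1
    (isCompact_Icc.uniformContinuousOn_of_continuous hy) (δ / 2) (by positivity)
  filter_upwards [(tendsto_const_div_natCast T).eventually_lt_const hδ,
    (tendsto_const_div_natCast T).eventually_lt_const hδ', eventually_gt_atTop 0,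
    hY (δ / 3) (by positivity)] with N hN1 hN2 hN hYN
  have hN' : (0 : ℝ) < N := by exact_mod_cast hN
  set τ : ℝ := T / N with hτ
  have hτpos : 0 < τ := by positivity
  have hNτ : N * τ = T := by rw [hτ]; field_simp
  have hmem : ∀ n ≤ N, (n : ℝ) * τ ∈ Icc 0 T := fun n hn => grid_mem_Icc hT.le hn
  have hsub : ∀ n < N, ∀ s ∈ Icc (n * τ) ((n + 1 : ℕ) * τ), s ∈ Icc 0 T := fun n hn s hs =>
    ⟨(hmem n hn.le).1.trans hs.1, hs.2.trans (hmem (n + 1) hn).2⟩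
  have hle : ∀ n : ℕ, (n : ℝ) * τ ≤ (n + 1 : ℕ) * τ := fun n => by gcongr; simp
  have hint : ∀ n < N, IntervalIntegrable (fun s => f (y s, s)) volume (n * τ)
      ((n + 1 : ℕ) * τ) := fun n hn => by
    refine ContinuousOn.intervalIntegrable ?_
    rw [uIcc_of_le (hle n)]
    exact hfc.mono (hsub n hn)
  have hsplit : ∫ s in (0 : ℝ)..T, f (y s, s)
      = ∑ n ∈ Finset.range N, ∫ s in (n * τ)..((n + 1 : ℕ) * τ), f (y s, s) := by
    rw [sum_integral_adjacent_intervals (a := fun n : ℕ => (n : ℝ) * τ) hint]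
    simp [hNτ]
  have hstep : ∀ n ∈ Finset.range N, ‖τ • f (Y N n, (n + 1 : ℕ) * τ)
      - ∫ s in (n * τ)..((n + 1 : ℕ) * τ), f (y s, s)‖ ≤ η * τ := by
    intro n hn
    have hn := Finset.mem_range.1 hn
    have hab : ((n + 1 : ℕ) : ℝ) * τ - n * τ = τ := by push_cast; ring
    have e : τ • f (Y N n, (n + 1 : ℕ) * τ)
        = ∫ _ in (n * τ)..((n + 1 : ℕ) * τ), f (Y N n, (n + 1 : ℕ) * τ) := by
      rw [intervalIntegral.integral_const, hab]
    rw [e, ← intervalIntegral.integral_sub (continuous_const.intervalIntegrable _ _) (hint n hn)]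
    refine (intervalIntegral.norm_integral_le_of_norm_le_const (C := η) fun s hs => ?_).trans_eq ?_
    · rw [uIoc_of_le (hle n)] at hs
      have hs' : s ∈ Icc (n * τ) ((n + 1 : ℕ) * τ) := ⟨hs.1.le, hs.2⟩
      rw [← dist_eq_norm, dist_comm]
      refine (hfδ (a := (y s, s)) ?_ ⟨s, hsub n hn s hs', rfl⟩).le
      have d1 : dist (y s) (y (n * τ)) < δ / 2 := by
        refine hyδ s (hsub n hn s hs') _ (hmem n hn.le) ?_
        rw [Real.dist_eq, abs_lt]
        constructor <;> linarith [hs'.1, hs'.2]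
      have d2 : dist (y (n * τ)) (Y N n) ≤ δ / 3 := by
        rw [dist_comm, dist_eq_norm]
        exact hYN n hn.le
      rw [Prod.dist_eq, max_lt_iff]
      refine ⟨?_, ?_⟩
      · linarith [dist_triangle (y s) (y (n * τ)) (Y N n)]
      · rw [Real.dist_eq, abs_lt]
        constructor <;> simp only <;> linarith [hs'.1, hs'.2]
    · rw [hab, abs_of_pos hτpos]
  rw [hsplit, dist_eq_norm, ← Finset.sum_sub_distrib]
  refine (norm_sum_le_of_le _ hstep).trans_lt ?_
  rw [Finset.sum_const, Finset.card_range, nsmul_eq_mul]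
  calc (N : ℝ) * (η * τ) = η * (N * τ) := by ring
    _ = ε / 2 := by rw [hNτ, hη]; field_simp
    _ < ε := by linarith

/-! ### Quantum Fisher information of an unnormalized family -/

section QFI

variable {E : Type*} [NormedAddCommGroup E] [InnerProductSpace ℂ E]

theorem re_inner_self (v : E) : (inner ℂ v v).re = ‖v‖ ^ 2 :=
  inner_self_eq_norm_sq (𝕜 := ℂ) v

/-- `4 (‖φ'‖² / ‖φ‖² - |⟨φ, φ'⟩|² / ‖φ‖⁴)`: differentiating the normalization factor only
contributes a multiple of `φ`, which the projection in `pureQFI` removes. -/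
theorem pureQFI_normalized {φ : ℝ → E} {φ' : E} {x : ℝ} (hφ : HasDerivAt φ φ' x)
    (h0 : φ x ≠ 0) :
    pureQFI (normalized φ) x
      = 4 * (‖φ'‖ ^ 2 / ‖φ x‖ ^ 2 - ‖inner ℂ (φ x) φ'‖ ^ 2 / ‖φ x‖ ^ 4) := by
  have hn0 : ‖φ x‖ ≠ 0 := norm_ne_zero_iff.2 h0
  have hdiff : DifferentiableAt ℝ (fun y => ‖φ y‖⁻¹) x := by
    have h1 : HasDerivAt (fun y => inner ℂ (φ y) (φ y)) _ x := hφ.inner ℂ hφ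
    have h2 : DifferentiableAt ℝ (fun y => (inner ℂ (φ y) (φ y)).re) x :=
      (Complex.reCLM.hasFDerivAt.comp_hasDerivAt x h1).differentiableAt
    simp only [re_inner_self] at h2
    have h4 : (fun y => ‖φ y‖) = fun y => Real.sqrt (‖φ y‖ ^ 2) := by
      funext y
      rw [Real.sqrt_sq (norm_nonneg _)]
    have h5 : DifferentiableAt ℝ (fun y => ‖φ y‖) x := by
      rw [h4]
      exact h2.sqrt (pow_ne_zero 2 hn0)
    exact h5.inv hn0
  obtain ⟨c, hc⟩ : ∃ c, HasDerivAt (fun y => ‖φ y‖⁻¹) c x := ⟨_, hdiff.hasDerivAt⟩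
  set n : ℝ := ‖φ x‖⁻¹ with hn
  set a : ℂ := inner ℂ (φ x) φ' with ha
  have hder : HasDerivAt (normalized φ) ((n : ℂ) • φ' + (c : ℂ) • φ x) x :=
    hc.ofReal_comp.smul hφ
  have hself : inner ℂ (φ x) (φ x) = ((‖φ x‖ ^ 2 : ℝ) : ℂ) := by
    rw [inner_self_eq_norm_sq_to_K]
    norm_cast
  have hnn : (n : ℂ) * ((‖φ x‖ : ℝ) : ℂ) = 1 := by
    rw [hn]
    norm_cast
    exact inv_mul_cancel₀ hn0
  have hproj : (n : ℂ) • φ' + (c : ℂ) • φ x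
      - inner ℂ (normalized φ x) ((n : ℂ) • φ' + (c : ℂ) • φ x) • normalized φ x
      = (n : ℂ) • φ' - ((n : ℂ) ^ 3 * a) • φ x := by
    have hnx : normalized φ x = (n : ℂ) • φ x := rfl
    rw [hnx, inner_smul_left, inner_add_right, inner_smul_right, inner_smul_right, ← ha, hself,
      Complex.conj_ofReal, smul_smul, add_sub_assoc, ← sub_smul, sub_eq_add_neg _ (_ • _),
      ← neg_smul]
    congr 2
    push_cast
    linear_combination (-(c : ℂ) * (n * ‖φ x‖ + 1)) * hnn
  have hre : RCLike.re (inner ℂ ((n : ℂ) • φ') (((n : ℂ) ^ 3 * a) • φ x)) = n ^ 4 * ‖a‖ ^ 2 := by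
    rw [inner_smul_left, inner_smul_right, ← inner_conj_symm, ← ha, Complex.conj_ofReal]
    have : (n : ℂ) * ((n : ℂ) ^ 3 * a * (starRingEnd ℂ) a) = ((n ^ 4 * ‖a‖ ^ 2 : ℝ) : ℂ) := by
      have := Complex.mul_conj' a
      push_cast
      linear_combination (n : ℂ) ^ 4 * this
    rw [this]
    exact Complex.ofReal_re _
  unfold pureQFI
  rw [hder.deriv, hproj, norm_sub_sq (𝕜 := ℂ), hre, norm_smul, norm_smul, norm_mul, norm_pow,
    Complex.norm_real, Real.norm_of_nonneg (by positivity : 0 ≤ n), hn]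
  field_simp
  ring

end QFI

/-- When the gap between the two Fisher informations (up to a factor `4`) closes.
Here `q s = Δ + 2 s W + s² (1 - p)` is the integrated jump intensity of `∂ₓψ̃ + i s ψ̃`, which is
nonnegative for every `s`, and `-b / p` is the gauge `∂ₓθ`. -/
theorem fisher_gap_eq_zero_iff {p W Δ r b : ℝ} (hp : 0 < p)
    (hq : ∀ s : ℝ, 0 ≤ Δ + 2 * s * W + s ^ 2 * (1 - p)) :
    Δ - (b + W) ^ 2 + (r ^ 2 + b ^ 2) / p = 0 ↔
      r = 0 ∧ Δ + 2 * (-b / p) * W + (-b / p) ^ 2 * (1 - p) = 0 := by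
  set c := -b / p with hc
  set Z := W + c * (1 - p) with hZ
  have hb : b = -c * p := by rw [hc]; field_simp
  have hgap : Δ - (b + W) ^ 2 + (r ^ 2 + b ^ 2) / p
      = (Δ + 2 * c * W + c ^ 2 * (1 - p)) - Z ^ 2 + r ^ 2 / p := by
    rw [hZ, hb]
    field_simp
    ring
  -- Nonnegativity at `s = c - Z`.
  have hqZ : (1 + p) * Z ^ 2 ≤ Δ + 2 * c * W + c ^ 2 * (1 - p) := by
    have := hq (c - Z)
    rw [hZ] at this ⊢
    nlinarith [this]
  rw [hgap]
  have hr : 0 ≤ r ^ 2 / p := by positivity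
  have hZ2 : 0 ≤ Z ^ 2 := sq_nonneg Z
  constructor
  · intro h
    have hZ0 : Z ^ 2 = 0 := by
      have : p * Z ^ 2 ≤ 0 := by nlinarith
      nlinarith
    have hr0 : r ^ 2 / p = 0 := by nlinarith
    refine ⟨?_, by nlinarith⟩
    rcases div_eq_zero_iff.1 hr0 with h | h
    · exact pow_eq_zero_iff two_ne_zero |>.1 h
    · exact absurd h hp.ne'
  · rintro ⟨hr0, hq0⟩
    have : Z ^ 2 = 0 := by nlinarith
    rw [hq0, this, hr0]
    simp

/-! ### The no-jump evolution and its derivative in the parameter -/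

/-- The point of `[0, T]` nearest to `t` (for `0 ≤ T`). Precomposing with it turns continuity on
`[0, T]` into continuity on the whole line. -/
noncomputable def clamp (T t : ℝ) : ℝ := max 0 (min T t)

theorem continuous_clamp (T : ℝ) : Continuous (clamp T) := by
  unfold clamp
  fun_prop

theorem clamp_mem {T : ℝ} (hT : 0 ≤ T) (t : ℝ) : clamp T t ∈ Icc 0 T :=
  ⟨le_max_left _ _, max_le hT (min_le_left _ _)⟩

theorem clamp_of_mem {T t : ℝ} (ht : t ∈ Icc 0 T) : clamp T t = t := by
  rw [clamp, min_eq_right ht.2, max_eq_right ht.1]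

section

variable {E : Type*} [NormedAddCommGroup E] [InnerProductSpace ℂ E]

theorem hasDerivAt_clm_apply_const {f : ℝ → E →L[ℂ] E} {f' : E →L[ℂ] E} {x : ℝ}
    (h : HasDerivAt f f' x) (v : E) : HasDerivAt (fun y => f y v) (f' v) x :=
  ((ContinuousLinearMap.apply ℂ E v).restrictScalars ℝ).hasFDerivAt.comp_hasDerivAt x h

end

namespace Model

variable {E : Type*} [NormedAddCommGroup E] [InnerProductSpace ℂ E] [CompleteSpace E]
  {J : Type*} [Fintype J]

/-- The standing regularity assumptions on a sensing model over the time interval `[0, T]`. -/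
structure Regular (S : Model E J) (T : ℝ) : Prop where
  H₀_sa : ∀ x : ℝ, ∀ t ∈ Icc 0 T, IsSelfAdjoint (S.H₀ x t)
  H₁_sa : ∀ t ∈ Icc 0 T, IsSelfAdjoint (S.H₁ t)
  γ_nonneg : ∀ j, ∀ t ∈ Icc 0 T, 0 ≤ S.γ j t
  H₀_cont : ContinuousOn (fun p : ℝ × ℝ => S.H₀ p.1 p.2) (univ ×ˢ Icc 0 T)
  H₀_diff : ∀ t ∈ Icc 0 T, Differentiable ℝ (fun x => S.H₀ x t)
  H₀_deriv_cont : ContinuousOn (fun p : ℝ × ℝ => deriv (fun x => S.H₀ x p.2) p.1)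
    (univ ×ˢ Icc 0 T)
  H₁_cont : ContinuousOn S.H₁ (Icc 0 T)
  γ_cont : ∀ j, ContinuousOn (S.γ j) (Icc 0 T)

variable (S : Model E J)

/-- The generator `-i Hⁿʰ_x(t)`, with `t` clamped to `[0, T]`. -/
noncomputable def gen (T x t : ℝ) : E →L[ℂ] E := (-Complex.I) • S.Hnh x (clamp T t)

/-- The parameter derivative `-i ∂ₓH₀ₓ(t)` of the generator, with `t` clamped to `[0, T]`. -/
noncomputable def genDeriv (T x t : ℝ) : E →L[ℂ] E :=
  (-Complex.I) • deriv (fun y => S.H₀ y (clamp T t)) x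

/-- The jump form `∑ⱼ γⱼ(t) ⟨Lⱼ a, Lⱼ b⟩`, with `t` clamped to `[0, T]`. -/
noncomputable def jumpForm (T t : ℝ) (a b : E) : ℂ :=
  ∑ j, (S.γ j (clamp T t) : ℂ) * inner ℂ (S.L j a) (S.L j b)

variable {S} {T : ℝ}

omit [Fintype J] in
theorem Regular.continuous_gamma (h : S.Regular T) (hT : 0 < T) (j : J) :
    Continuous fun t => S.γ j (clamp T t) :=
  (h.γ_cont j).comp_continuous (continuous_clamp T) (clamp_mem hT.le)

theorem Regular.continuous_gen (h : S.Regular T) (hT : 0 < T) :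
    Continuous fun z : ℝ × ℝ => S.gen T z.1 z.2 := by
  have hc : Continuous fun z : ℝ × ℝ => clamp T z.2 := (continuous_clamp T).comp continuous_snd
  have h0 : Continuous fun z : ℝ × ℝ => S.H₀ z.1 (clamp T z.2) :=
    h.H₀_cont.comp_continuous (continuous_fst.prodMk hc) fun z => ⟨mem_univ _, clamp_mem hT.le _⟩
  have h1 : Continuous fun z : ℝ × ℝ => S.H₁ (clamp T z.2) :=
    h.H₁_cont.comp_continuous hc fun z => clamp_mem hT.le _
  have hγ : ∀ j, Continuous fun z : ℝ × ℝ => (S.γ j (clamp T z.2) : ℂ) := fun j =>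
    Complex.continuous_ofReal.comp ((h.continuous_gamma hT j).comp continuous_snd)
  unfold gen Hnh
  have hsum : Continuous fun z : ℝ × ℝ => ∑ j, (S.γ j (clamp T z.2) : ℂ) •
      (ContinuousLinearMap.adjoint (S.L j) * S.L j) :=
    continuous_finsetSum _ fun j _ => (hγ j).smul continuous_const
  exact ((h0.add h1).sub (hsum.const_smul (Complex.I / 2))).const_smul (-Complex.I)

omit [Fintype J] in
theorem Regular.continuous_genDeriv (h : S.Regular T) (hT : 0 < T) :
    Continuous fun z : ℝ × ℝ => S.genDeriv T z.1 z.2 := by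
  have hc : Continuous fun z : ℝ × ℝ => clamp T z.2 := (continuous_clamp T).comp continuous_snd
  exact (h.H₀_deriv_cont.comp_continuous (continuous_fst.prodMk hc)
    fun z => ⟨mem_univ _, clamp_mem hT.le _⟩).const_smul (-Complex.I)

theorem Regular.hasDerivAt_Hnh (h : S.Regular T) {t : ℝ} (ht : t ∈ Icc 0 T) (x : ℝ) :
    HasDerivAt (fun y => S.Hnh y t) (deriv (fun y => S.H₀ y t) x) x :=
  (((h.H₀_diff t ht) x).hasDerivAt.add_const _).sub_const _

theorem Regular.hasDerivAt_gen (h : S.Regular T) (hT : 0 < T) (x t : ℝ) :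
    HasDerivAt (fun y => S.gen T y t) (S.genDeriv T x t) x :=
  (h.hasDerivAt_Hnh (clamp_mem hT.le t) x).const_smul (-Complex.I)

/-- The Dyson series only sees the generator on `[0, T]`, so it is a Picard series of the clamped
generator. -/
theorem dysonTerm_eq_volterraTerm (S : Model E J) (T x : ℝ) (n : ℕ) {t : ℝ} (ht : t ∈ Icc 0 T) :
    dysonTerm (S.Hnh x) n t = volterraTerm (S.gen T x) (fun _ => 1) n t := by
  induction n generalizing t with
  | zero => rfl
  | succ n ih =>
    refine integral_congr fun s hs => ?_
    rw [uIcc_of_le ht.1] at hs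
    have hs' : s ∈ Icc 0 T := ⟨hs.1, hs.2.trans ht.2⟩
    simp only [gen, clamp_of_mem hs', ih hs', smul_mul_assoc]

/-- The time-ordered exponential, a priori only a sum over the Dyson series, solves
`M' = -i Hⁿʰ M` on `[0, T]`. -/
theorem Regular.exists_propagator (h : S.Regular T) (hT : 0 < T) (x : ℝ) :
    ∃ M : ℝ → E →L[ℂ] E, Continuous M ∧ (∀ t ∈ Icc 0 T, M t = S.Mcheck x t) ∧ M 0 = 1 ∧
      ∀ t ∈ Icc 0 T, HasDerivAt M (S.gen T x t * M t) t := by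
  have hK : Continuous (S.gen T x) := (h.continuous_gen hT).comp (Continuous.prodMk_right x)
  obtain ⟨M, hMc, hMs, hM0, hMd⟩ := exists_hasSum_volterraTerm (g := fun _ => (1 : E →L[ℂ] E))
    (g' := fun _ => 0) hK (fun t => hasDerivAt_const t _) hT.le
  refine ⟨M, hMc, fun t ht => ?_, hM0, fun t ht => by simpa using hMd t ht⟩
  rw [← (hMs t ht).tsum_eq]
  exact tsum_congr fun n => (dysonTerm_eq_volterraTerm S T x n ht).symm

/-- The propagator `M` and its parameter derivative `Q` solve the linear equation and its
variational equation. -/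
theorem Regular.exists_propagator_deriv (h : S.Regular T) (hT : 0 < T) (x : ℝ) :
    ∃ M Q : ℝ → E →L[ℂ] E,
      Continuous M ∧ Continuous Q ∧ M 0 = 1 ∧ Q 0 = 0 ∧
      (∀ t ∈ Icc 0 T, S.Mcheck x t = M t) ∧
      (∀ t ∈ Icc 0 T, HasDerivAt (fun y => S.Mcheck y t) (Q t) x) ∧
      (∀ t ∈ Icc 0 T, HasDerivAt M (S.gen T x t * M t) t) ∧
      ∀ t ∈ Icc 0 T, HasDerivAt Q (S.genDeriv T x t * M t + S.gen T x t * Q t) t := by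
  choose M hMc hM hM0 hMd using h.exists_propagator hT
  have hK : Continuous (S.gen T x) := (h.continuous_gen hT).comp (Continuous.prodMk_right x)
  have hK' : Continuous (S.genDeriv T x) :=
    (h.continuous_genDeriv hT).comp (Continuous.prodMk_right x)
  have hsrc : Continuous fun t => S.genDeriv T x t * M x t := hK'.mul (hMc x)
  obtain ⟨Q, hQc, -, hQ0, hQd⟩ := exists_hasSum_volterraTerm
    (g := fun t => ∫ s in (0 : ℝ)..t, S.genDeriv T x s * M x s)
    (g' := fun t => S.genDeriv T x t * M x t) hK
    (fun t => (hsrc.integral_hasStrictDerivAt 0 t).hasDerivAt) hT.le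
  have hQ0 : Q 0 = 0 := by simpa using hQ0
  refine ⟨M x, Q, hMc x, hQc, hM0 x, hQ0, fun t ht => (hM x t ht).symm, fun t ht => ?_,
    hMd x, hQd⟩
  have := hasDerivAt_parameter_of_linear_ode (h.continuous_gen hT) (h.continuous_genDeriv hT)
    (fun y t => h.hasDerivAt_gen hT y t) hMd (x := x) (fun y => by rw [hM0, hM0]) hQ0 hQd ht
  refine this.congr_of_eventuallyEq (Eventually.of_forall fun y => ?_)
  exact (hM y t ht).symm

/-! ### Conservation of probability -/

/-- The anti-Hermitian part of `Hⁿʰ` is exactly the jump form; the Hamiltonians cancel. -/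
theorem inner_gen_add (h : S.Regular T) (hT : 0 < T) (x t : ℝ) (a b : E) :
    inner ℂ (S.gen T x t a) b + inner ℂ a (S.gen T x t b) = -S.jumpForm T t a b := by
  have ht := clamp_mem hT.le t
  have h0 : inner ℂ (S.H₀ x (clamp T t) a) b = inner ℂ a (S.H₀ x (clamp T t) b) :=
    (h.H₀_sa x _ ht).isSymmetric a b
  have h1 : inner ℂ (S.H₁ (clamp T t) a) b = inner ℂ a (S.H₁ (clamp T t) b) :=
    (h.H₁_sa _ ht).isSymmetric a b
  simp only [gen, Hnh, jumpForm, smul_apply, sub_apply,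
    add_apply, sum_apply, mul_apply_eq_comp,
    inner_smul_left, inner_smul_right, inner_sub_left, inner_sub_right, inner_add_left,
    inner_add_right, sum_inner, inner_sum, ContinuousLinearMap.adjoint_inner_left,
    ContinuousLinearMap.adjoint_inner_right, h0, h1, map_neg, map_div₀, Complex.conj_I,
    Complex.conj_ofReal, Complex.conj_ofNat]
  ring_nf
  rw [Complex.I_sq]
  ring

omit [Fintype J] in
/-- `∂ₓH₀` is self-adjoint because `H₀` is, so `-i ∂ₓH₀` changes no norm to first order. -/
theorem re_inner_genDeriv_self (h : S.Regular T) (hT : 0 < T) (x t : ℝ) (a : E) :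
    (inner ℂ a (S.genDeriv T x t a)).re = 0 := by
  have ht := clamp_mem hT.le t
  have hsa : IsSelfAdjoint (deriv (fun y => S.H₀ y (clamp T t)) x) := by
    have hd := ((h.H₀_diff _ ht) x).hasDerivAt
    have hs := hd.star
    simp only [(h.H₀_sa _ _ ht).star_eq] at hs
    exact hs.unique hd
  have hreal : (inner ℂ a (deriv (fun y => S.H₀ y (clamp T t)) x a)).im = 0 := by
    rw [← Complex.conj_eq_iff_im, inner_conj_symm]
    exact hsa.isSymmetric a a
  simp [genDeriv, inner_smul_right, hreal]

theorem Regular.continuous_jumpForm (h : S.Regular T) (hT : 0 < T) {X : Type*}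
    [TopologicalSpace X] {f : X → ℝ} {a b : X → E} (hf : Continuous f) (ha : Continuous a)
    (hb : Continuous b) : Continuous fun z => S.jumpForm T (f z) (a z) (b z) := by
  unfold jumpForm
  refine continuous_finsetSum _ fun j _ => ?_
  exact (Complex.continuous_ofReal.comp ((h.continuous_gamma hT j).comp hf)).mul
    (((S.L j).continuous.comp ha).inner ((S.L j).continuous.comp hb))

/-- Probability lost from the no-jump branch reappears as integrated jump intensity. -/
theorem norm_sq_add_integral_jumpForm (h : S.Regular T) (hT : 0 < T) {x : ℝ} {u : ℝ → E}
    (huc : Continuous u) (hu : ∀ t ∈ Icc 0 T, HasDerivAt u (S.gen T x t (u t)) t) :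
    inner ℂ (u T) (u T) + ∫ t in (0 : ℝ)..T, S.jumpForm T t (u t) (u t)
      = inner ℂ (u 0) (u 0) := by
  have hc : Continuous fun t => S.jumpForm T t (u t) (u t) :=
    h.continuous_jumpForm hT continuous_id huc huc
  have := integral_eq_sub_of_hasDerivAt (a := 0) (b := T)
    (f := fun t => inner ℂ (u t) (u t)) (f' := fun t => -S.jumpForm T t (u t) (u t))
    (fun t ht => by
      rw [uIcc_of_le hT.le] at ht
      rw [← inner_gen_add h hT x, add_comm]
      exact (hu t ht).inner ℂ (hu t ht)) (hc.neg.intervalIntegrable _ _)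
  rw [intervalIntegral.integral_neg] at this
  linear_combination -this

/-- The derivative in `x` of conservation of probability. -/
theorem re_inner_add_integral_jumpForm (h : S.Regular T) (hT : 0 < T) {x : ℝ} {u v : ℝ → E}
    (huc : Continuous u) (hvc : Continuous v)
    (hu : ∀ t ∈ Icc 0 T, HasDerivAt u (S.gen T x t (u t)) t) (hv0 : v 0 = 0)
    (hv : ∀ t ∈ Icc 0 T, HasDerivAt v (S.genDeriv T x t (u t) + S.gen T x t (v t)) t) :
    (inner ℂ (u T) (v T)).re + ∫ t in (0 : ℝ)..T, (S.jumpForm T t (u t) (v t)).re = 0 := by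
  have hc : Continuous fun t => (S.jumpForm T t (u t) (v t)).re :=
    Complex.continuous_re.comp (h.continuous_jumpForm hT continuous_id huc hvc)
  have := integral_eq_sub_of_hasDerivAt (a := 0) (b := T)
    (f := fun t => (inner ℂ (u t) (v t)).re)
    (f' := fun t => -(S.jumpForm T t (u t) (v t)).re)
    (fun t ht => by
      rw [uIcc_of_le hT.le] at ht
      have hd := Complex.reCLM.hasFDerivAt.comp_hasDerivAt t ((hu t ht).inner ℂ (hv t ht))
      refine hd.congr_deriv ?_
      have h1 := congrArg Complex.re (inner_gen_add h hT x t (u t) (v t))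
      have h2 := re_inner_genDeriv_self h hT x t (u t)
      simp only [Complex.add_re, Complex.neg_re] at h1
      simp only [Complex.reCLM_apply, inner_add_right, Complex.add_re]
      linarith) (hc.neg.intervalIntegrable _ _)
  rw [intervalIntegral.integral_neg, hv0, inner_zero_right] at this
  simp only [Complex.zero_re, sub_zero] at this
  linarith

/-- The no-jump branch never dies out: a solution that vanishes at time `T` vanishes at time `0`,
by uniqueness for the equation run backwards. -/
theorem eq_zero_of_final_eq_zero (h : S.Regular T) (hT : 0 < T) {x : ℝ} {u : ℝ → E}
    (hu : ∀ t ∈ Icc 0 T, HasDerivAt u (S.gen T x t (u t)) t) (huT : u T = 0) : u 0 = 0 := by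
  have hK : Continuous (S.gen T x) := (h.continuous_gen hT).comp (Continuous.prodMk_right x)
  obtain ⟨C, hC⟩ := isCompact_Icc.exists_bound_of_continuousOn (s := Icc 0 T) hK.continuousOn
  have hmem : ∀ s ∈ Icc 0 T, T - s ∈ Icc 0 T := fun s hs =>
    ⟨by linarith [hs.2], by linarith [hs.1]⟩
  have hd : ∀ s ∈ Icc 0 T,
      HasDerivAt (fun s => u (T - s)) (-S.gen T x (T - s) (u (T - s))) s := fun s hs => by
    have := (hu _ (hmem s hs)).scomp s ((hasDerivAt_id s).const_sub T)
    simpa [Function.comp_def] using this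
  have := eq_zero_of_abs_deriv_le_mul_abs_self_of_eq_zero_right (f := fun s => u (T - s))
    (f' := fun s => -S.gen T x (T - s) (u (T - s))) (K := C) (a := 0) (b := T)
    (fun s hs => (hd s hs).continuousAt.continuousWithinAt)
    (fun s hs => (hd s ⟨hs.1, hs.2.le⟩).hasDerivWithinAt) (by simpa using huT)
    (fun s hs => by
      rw [norm_neg]
      exact (ContinuousLinearMap.le_opNorm _ _).trans
        (mul_le_mul_of_nonneg_right (hC _ (hmem s ⟨hs.1, hs.2.le⟩)) (norm_nonneg _)))
    T ⟨hT.le, le_rfl⟩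
  simpa using this

/-! ### The collision model in the continuous-time limit -/

variable (S)

/-- The derivative in `x` of the product of the first `n` no-jump operators, by the Leibniz
rule. -/
noncomputable def prodCheckDeriv (x Δt : ℝ) : ℕ → E →L[ℂ] E
  | 0 => 0
  | n + 1 => S.stepCheck x ((n + 1 : ℕ) * Δt) Δt * prodCheckDeriv x Δt n -
      (Complex.I * (Δt : ℂ)) •
        (deriv (fun y => S.H₀ y ((n + 1 : ℕ) * Δt)) x * S.prodCheck x Δt n)

/-- The vector of the joint space whose component is `A N` on the retained outcome and
`√(γⱼ Δt) Lⱼ (A n)` on the outcome with first jump in step `n + 1` through channel `j`. -/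
noncomputable def outcomeVec (T : ℝ) (N : ℕ) (A : ℕ → E) :
    PiLp 2 (fun _ : Option (Fin N × J) => E) :=
  WithLp.toLp 2 fun ω => match ω with
    | none => A N
    | some (n, j) => S.stepJump j (((n : ℕ) + 1 : ℕ) * (T / N)) (T / N) (A n)

theorem jointVec_eq_outcomeVec (T : ℝ) (N : ℕ) (ψ : E) (x : ℝ) :
    S.jointVec T N ψ x = S.outcomeVec T N fun n => S.prodCheck x (T / N) n ψ := by
  unfold jointVec outcomeVec
  congr 1
  funext ω
  rcases ω with _ | ⟨n, j⟩ <;> rfl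

variable {S}

theorem hasDerivAt_prodCheck (h : S.Regular T) (hT : 0 < T) (x : ℝ) {N n : ℕ} (hn : n ≤ N) :
    HasDerivAt (fun y => S.prodCheck y (T / N) n) (S.prodCheckDeriv x (T / N) n) x := by
  induction n with
  | zero => exact hasDerivAt_const x _
  | succ n ih =>
    have ht := grid_mem_Icc hT.le hn
    have hs : HasDerivAt (fun y => S.stepCheck y ((n + 1 : ℕ) * (T / N)) (T / N))
        (-((Complex.I * ((T / N : ℝ) : ℂ)) •
          deriv (fun y => S.H₀ y ((n + 1 : ℕ) * (T / N))) x)) x :=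
      ((h.hasDerivAt_Hnh ht x).const_smul (Complex.I * ((T / N : ℝ) : ℂ))).const_sub _
    refine (hs.mul (ih (by omega))).congr_deriv ?_
    rw [prodCheckDeriv, neg_mul, smul_mul_assoc, add_comm, sub_eq_add_neg]

theorem hasDerivAt_jointVec (h : S.Regular T) (hT : 0 < T) (N : ℕ) (ψ : E) (x : ℝ) :
    HasDerivAt (S.jointVec T N ψ)
      (S.outcomeVec T N fun n => S.prodCheckDeriv x (T / N) n ψ) x := by
  have hpi : HasDerivAt (fun y => (S.jointVec T N ψ y).ofLp)
      (S.outcomeVec T N fun n => S.prodCheckDeriv x (T / N) n ψ).ofLp x := by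
    rw [hasDerivAt_pi]
    rintro (_ | ⟨n, j⟩)
    · exact hasDerivAt_clm_apply_const (hasDerivAt_prodCheck h hT x le_rfl) ψ
    · have hd := hasDerivAt_clm_apply_const (hasDerivAt_prodCheck h hT x n.2.le) ψ
      exact ((S.stepJump j (((n : ℕ) + 1 : ℕ) * (T / N)) (T / N)).restrictScalars
        ℝ).hasFDerivAt.comp_hasDerivAt x hd
  exact (PiLp.continuousLinearEquiv 2 ℝ
    (fun _ : Option (Fin N × J) => E)).symm.toContinuousLinearMap.hasFDerivAt.comp_hasDerivAt x hpi

theorem inner_outcomeVec (h : S.Regular T) (hT : 0 < T) {N : ℕ} (A B : ℕ → E) :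
    inner ℂ (S.outcomeVec T N A) (S.outcomeVec T N B) = inner ℂ (A N) (B N) +
      ∑ n ∈ Finset.range N, (T / N) • S.jumpForm T ((n + 1 : ℕ) * (T / N)) (A n) (B n) := by
  rw [PiLp.inner_apply, Fintype.sum_option, Fintype.sum_prod_type,
    ← Fin.sum_univ_eq_sum_range (fun n => (T / N : ℝ) •
      S.jumpForm T ((n + 1 : ℕ) * (T / N)) (A n) (B n)) N]
  congr 1
  refine Finset.sum_congr rfl fun n _ => ?_
  rw [jumpForm, Finset.smul_sum]
  refine Finset.sum_congr rfl fun j _ => ?_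
  have ht := grid_mem_Icc hT.le (N := N) (n := n + 1) n.2
  have hnn : 0 ≤ S.γ j (((n : ℕ) + 1 : ℕ) * (T / N)) * (T / N) :=
    mul_nonneg (h.γ_nonneg j _ ht) (by positivity)
  have hsq := Real.mul_self_sqrt hnn
  simp only [outcomeVec, stepJump, smul_apply, inner_smul_left, inner_smul_right,
    Complex.conj_ofReal]
  rw [clamp_of_mem ht, ← mul_assoc, ← Complex.ofReal_mul, hsq, Complex.real_smul,
    Complex.ofReal_mul]
  ring

/-- Over `N` steps the no-jump product applied to `ψ`, together with its `x`-derivative, is an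
Euler scheme for the coupled equations `u' = G u`, `v' = G' u + G v`. -/
theorem eventually_norm_prodCheck_sub_le (h : S.Regular T) (hT : 0 < T) {x : ℝ} {ψ : E}
    {u v : ℝ → E} (hu0 : u 0 = ψ)
    (hu : ∀ t ∈ Icc 0 T, HasDerivAt u (S.gen T x t (u t)) t) (hv0 : v 0 = 0)
    (hv : ∀ t ∈ Icc 0 T, HasDerivAt v (S.genDeriv T x t (u t) + S.gen T x t (v t)) t)
    {ε : ℝ} (hε : 0 < ε) :
    ∀ᶠ N : ℕ in atTop, ∀ n ≤ N,
      ‖(S.prodCheck x (T / N) n ψ, S.prodCheckDeriv x (T / N) n ψ)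
        - (u (n * (T / N)), v (n * (T / N)))‖ ≤ ε := by
  have hK : Continuous (S.gen T x) := (h.continuous_gen hT).comp (Continuous.prodMk_right x)
  have hK' : Continuous (S.genDeriv T x) :=
    (h.continuous_genDeriv hT).comp (Continuous.prodMk_right x)
  obtain ⟨C, hC⟩ := isCompact_Icc.exists_bound_of_continuousOn (s := Icc 0 T) hK.continuousOn
  obtain ⟨C', hC'⟩ := isCompact_Icc.exists_bound_of_continuousOn (s := Icc 0 T) hK'.continuousOn
  have h0 : (0 : ℝ) ∈ Icc 0 T := ⟨le_rfl, hT.le⟩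
  have hC0 : 0 ≤ C := (norm_nonneg _).trans (hC 0 h0)
  have hC'0 : 0 ≤ C' := (norm_nonneg _).trans (hC' 0 h0)
  refine euler_scheme_converges (F := E × E)
    (f := fun z t => (S.gen T x t z.1, S.genDeriv T x t z.1 + S.gen T x t z.2))
    (y := fun t => (u t, v t))
    (Y := fun N n => (S.prodCheck x (T / N) n ψ, S.prodCheckDeriv x (T / N) n ψ))
    ?_ hT (add_nonneg hC'0 hC0) ?_ (fun t ht => (hu t ht).prodMk (hv t ht)) ?_ ?_ hε
  · have e : Continuous fun z : (E × E) × ℝ => S.gen T x z.2 := hK.comp continuous_snd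
    have e' : Continuous fun z : (E × E) × ℝ => S.genDeriv T x z.2 := hK'.comp continuous_snd
    have f1 : Continuous fun z : (E × E) × ℝ => z.1.1 := continuous_fst.comp continuous_fst
    have f2 : Continuous fun z : (E × E) × ℝ => z.1.2 := continuous_snd.comp continuous_fst
    exact (e.clm_apply f1).prodMk ((e'.clm_apply f1).add (e.clm_apply f2))
  · intro t ht a b
    have h1 : ‖a.1 - b.1‖ ≤ ‖a - b‖ := norm_fst_le (a - b)
    have h2 : ‖a.2 - b.2‖ ≤ ‖a - b‖ := norm_snd_le (a - b)
    have b1 : ∀ w : E, ‖w‖ ≤ ‖a - b‖ → ‖S.gen T x t w‖ ≤ C * ‖a - b‖ := fun w hw =>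
      (ContinuousLinearMap.le_opNorm _ _).trans (mul_le_mul (hC t ht) hw (norm_nonneg _) hC0)
    have b2 : ‖S.genDeriv T x t (a.1 - b.1)‖ ≤ C' * ‖a - b‖ :=
      (ContinuousLinearMap.le_opNorm _ _).trans (mul_le_mul (hC' t ht) h1 (norm_nonneg _) hC'0)
    rw [Prod.mk_sub_mk, Prod.norm_mk, ← map_sub, add_sub_add_comm, ← map_sub, ← map_sub]
    refine max_le ?_ ?_
    · have := b1 _ h1
      nlinarith [norm_nonneg (a - b)]
    · refine (norm_add_le _ _).trans ?_
      rw [add_mul]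
      exact add_le_add b2 (b1 _ h2)
  · intro N
    simp [prodCheck, prodCheckDeriv, hu0, hv0]
  · intro N n hn
    have ht := grid_mem_Icc hT.le (N := N) (n := n + 1) hn
    have hsm : ∀ w : E, (T / N : ℝ) • ((-Complex.I) • w)
        = -((Complex.I * ((T / N : ℝ) : ℂ)) • w) := fun w => by
      rw [← Complex.coe_smul, smul_smul, ← neg_smul]
      congr 1
      ring
    simp only [gen, genDeriv, clamp_of_mem ht, smul_apply, prodCheck, prodCheckDeriv, stepCheck,
      Prod.smul_mk, Prod.mk_add_mk, smul_add, hsm, mul_apply_eq_comp, sub_apply, one_apply_eq_self]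
    refine Prod.ext ?_ ?_ <;> simp only <;> abel

/-- Inner products of outcome vectors converge to their continuous-time counterparts. The maps
`a` and `b` pick out of the pair (no-jump state, its `x`-derivative) the two vectors paired. -/
theorem tendsto_inner_outcomeVec (h : S.Regular T) (hT : 0 < T) {y : ℝ → E × E}
    (hy : Continuous y) {Y : ℕ → ℕ → E × E}
    (hY : ∀ ε > 0, ∀ᶠ N : ℕ in atTop, ∀ n ≤ N, ‖Y N n - y (n * (T / N))‖ ≤ ε)
    {a b : E × E → E} (ha : Continuous a) (hb : Continuous b) :
    Tendsto (fun N => inner ℂ (S.outcomeVec T N fun n => a (Y N n))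
        (S.outcomeVec T N fun n => b (Y N n))) atTop
      (𝓝 (inner ℂ (a (y T)) (b (y T)) +
        ∫ t in (0 : ℝ)..T, S.jumpForm T t (a (y t)) (b (y t)))) := by
  simp only [inner_outcomeVec h hT]
  have hfin : Tendsto (fun N => Y N N) atTop (𝓝 (y T)) := by
    rw [Metric.tendsto_nhds]
    intro ε hε
    filter_upwards [hY (ε / 2) (by positivity), eventually_gt_atTop 0] with N hN hN0
    have hN' : (N : ℝ) ≠ 0 := by positivity
    have := hN N le_rfl
    rw [mul_div_cancel₀ _ hN'] at this
    rw [dist_eq_norm]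
    linarith
  refine Tendsto.add ?_ ?_
  · exact ((ha.tendsto _).comp hfin).inner ((hb.tendsto _).comp hfin)
  · exact tendsto_riemann_sum (f := fun z : (E × E) × ℝ => S.jumpForm T z.2 (a z.1) (b z.1))
      (h.continuous_jumpForm hT continuous_snd (ha.comp continuous_fst) (hb.comp continuous_fst))
      hT hy.continuousOn hY

/-! ### Fisher informations in terms of the no-jump state -/

theorem prob_eq_norm_sq (S : Model E J) (T : ℝ) (ψ : E) (y : ℝ) :
    S.prob T ψ y = ‖S.psiTilde T ψ y‖ ^ 2 := by
  rw [prob, expect, Echeck, mul_apply_eq_comp, ContinuousLinearMap.adjoint_inner_right,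
    re_inner_self, psiTilde]

/-- The no-jump state `u = ψ̃` and its `x`-derivative `v` as solutions of the coupled linear
equations, and the gauge `∂ₓθ` in terms of them. -/
theorem exists_state (h : S.Regular T) (hT : 0 < T) (x : ℝ) (ψ : E) :
    ∃ u v : ℝ → E, Continuous u ∧ Continuous v ∧ u 0 = ψ ∧ v 0 = 0 ∧
      (∀ t ∈ Icc 0 T, S.psiTilde t ψ x = u t) ∧
      (∀ t ∈ Icc 0 T, HasDerivAt (S.psiTilde t ψ) (v t) x) ∧
      (∀ t ∈ Icc 0 T, HasDerivAt u (S.gen T x t (u t)) t) ∧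
      (∀ t ∈ Icc 0 T, HasDerivAt v (S.genDeriv T x t (u t) + S.gen T x t (v t)) t) ∧
      S.dTheta T ψ x = -(inner ℂ (u T) (v T)).im / ‖u T‖ ^ 2 := by
  obtain ⟨M, Q, hMc, hQc, hM0, hQ0, hM, hQ, hMd, hQd⟩ := h.exists_propagator_deriv hT x
  have hTm : T ∈ Icc 0 T := ⟨hT.le, le_rfl⟩
  refine ⟨fun t => M t ψ, fun t => Q t ψ, hMc.clm_apply continuous_const,
    hQc.clm_apply continuous_const, by simp [hM0], by simp [hQ0],
    fun t ht => by rw [psiTilde, hM t ht], fun t ht => hasDerivAt_clm_apply_const (hQ t ht) ψ,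
    fun t ht => hasDerivAt_clm_apply_const (hMd t ht) ψ,
    fun t ht => hasDerivAt_clm_apply_const (hQd t ht) ψ, ?_⟩
  have hadj : deriv (fun y => ContinuousLinearMap.adjoint (S.Mcheck y T)) x
      = ContinuousLinearMap.adjoint (Q T) := (hQ T hTm).star.deriv
  rw [dTheta, prob_eq_norm_sq, psiTilde, hM T hTm, expect, Fcheck, hadj, hM T hTm, smul_apply,
    mul_apply_eq_comp, inner_smul_right, ContinuousLinearMap.adjoint_inner_right,
    ← inner_conj_symm (Q T ψ)]
  simp only [Complex.mul_re, Complex.I_re, Complex.I_im, Complex.conj_im]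
  ring

omit [CompleteSpace E] in
theorem jumpForm_self (S : Model E J) (T t : ℝ) (a : E) :
    (S.jumpForm T t a a).re = ∑ j, S.γ j (clamp T t) * ‖S.L j a‖ ^ 2 := by
  simp only [jumpForm, Complex.re_sum, Complex.re_ofReal_mul, re_inner_self]

theorem jumpForm_self_nonneg (h : S.Regular T) (hT : 0 < T) (t : ℝ) (a : E) :
    0 ≤ (S.jumpForm T t a a).re := by
  rw [jumpForm_self]
  exact Finset.sum_nonneg fun j _ =>
    mul_nonneg (h.γ_nonneg j _ (clamp_mem hT.le t)) (by positivity)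

omit [CompleteSpace E] in
/-- The jump intensity of `b + i s a` is a quadratic polynomial in the real number `s`. -/
theorem jumpForm_self_add_smul (S : Model E J) (T t s : ℝ) (a b : E) :
    (S.jumpForm T t (b + (Complex.I * (s : ℂ)) • a) (b + (Complex.I * (s : ℂ)) • a)).re
      = (S.jumpForm T t b b).re + 2 * s * (S.jumpForm T t a b).im
        + s ^ 2 * (S.jumpForm T t a a).re := by
  simp only [jumpForm, Complex.re_sum, Complex.im_sum, Finset.mul_sum, ← Finset.sum_add_distrib]
  refine Finset.sum_congr rfl fun j _ => ?_
  have hsym : (inner ℂ (S.L j b) (S.L j a)).im = -(inner ℂ (S.L j a) (S.L j b)).im := by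
    rw [← inner_conj_symm, Complex.conj_im]
  simp only [map_add, map_smul, inner_add_left, inner_add_right, inner_smul_left,
    inner_smul_right, map_mul, Complex.conj_I, Complex.conj_ofReal, Complex.add_re,
    Complex.mul_re, Complex.mul_im, Complex.ofReal_re, Complex.ofReal_im, Complex.I_re,
    Complex.I_im, Complex.neg_re, Complex.neg_im, Complex.add_im, hsym]
  ring

/-- The integrand is continuous and nonnegative, so the integral vanishes only if the integrand
does, at every time. -/
theorem integral_jumpForm_self_eq_zero_iff (h : S.Regular T) (hT : 0 < T) {w : ℝ → E}
    (hw : Continuous w) :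
    ∫ t in (0 : ℝ)..T, (S.jumpForm T t (w t) (w t)).re = 0 ↔
      ∀ j, ∀ t ∈ Icc 0 T, 0 < S.γ j t → S.L j (w t) = 0 := by
  have hc : Continuous fun t => (S.jumpForm T t (w t) (w t)).re :=
    Complex.continuous_re.comp (h.continuous_jumpForm hT continuous_id hw hw)
  constructor
  · intro h0 j t ht hγ
    by_contra hL
    refine (integral_pos hT hc.continuousOn (fun t _ => jumpForm_self_nonneg h hT t _)
      ⟨t, ht, ?_⟩).ne' h0
    rw [jumpForm_self]
    refine Finset.sum_pos' (fun i _ => mul_nonneg (h.γ_nonneg i _ (clamp_mem hT.le t))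
      (by positivity)) ⟨j, Finset.mem_univ j, ?_⟩
    rw [clamp_of_mem ht]
    have := norm_pos_iff.2 hL
    positivity
  · intro h0
    refine (integral_congr (g := fun _ => (0 : ℝ)) fun t ht => ?_).trans (by simp)
    rw [uIcc_of_le hT.le] at ht
    simp only [jumpForm_self, clamp_of_mem ht]
    refine Finset.sum_eq_zero fun j _ => ?_
    rcases (h.γ_nonneg j t ht).eq_or_lt with hγ | hγ
    · rw [← hγ, zero_mul]
    · simp [h0 j t ht hγ]

/-- The collision-model Fisher information converges to that of the joint state with a continuum
of jump times. -/
theorem tendsto_collisionQFI (h : S.Regular T) (hT : 0 < T) {x : ℝ} {ψ : E} (hψ : ‖ψ‖ = 1)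
    {u v : ℝ → E} (huc : Continuous u) (hvc : Continuous v) (hu0 : u 0 = ψ)
    (hu : ∀ t ∈ Icc 0 T, HasDerivAt u (S.gen T x t (u t)) t) (hv0 : v 0 = 0)
    (hv : ∀ t ∈ Icc 0 T, HasDerivAt v (S.genDeriv T x t (u t) + S.gen T x t (v t)) t) :
    Tendsto (fun N : ℕ => S.collisionQFI T N ψ x) atTop
      (𝓝 (4 * (‖v T‖ ^ 2 + (∫ t in (0 : ℝ)..T, (S.jumpForm T t (v t) (v t)).re)
        - ((inner ℂ (u T) (v T)).im
          + ∫ t in (0 : ℝ)..T, (S.jumpForm T t (u t) (v t)).im) ^ 2))) := by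
  have hY := fun ε hε => eventually_norm_prodCheck_sub_le h hT hu0 hu hv0 hv (ε := ε) hε
  have hlim := fun a b ha hb => tendsto_inner_outcomeVec h hT (huc.prodMk hvc) hY (a := a) (b := b)
    ha hb
  have huu := hlim Prod.fst Prod.fst continuous_fst continuous_fst
  have huv := hlim Prod.fst Prod.snd continuous_fst continuous_snd
  have hvv := hlim Prod.snd Prod.snd continuous_snd continuous_snd
  simp only [← jointVec_eq_outcomeVec] at huu huv hvv
  set D : ∀ N : ℕ, PiLp 2 (fun _ : Option (Fin N × J) => E) :=
    fun N => S.outcomeVec T N fun n => S.prodCheckDeriv x (T / N) n ψ with hD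
  have hcont : ∀ {a b : ℝ → E}, Continuous a → Continuous b →
      IntervalIntegrable (fun t => S.jumpForm T t (a t) (b t)) volume 0 T := fun ha hb =>
    (h.continuous_jumpForm hT continuous_id ha hb).intervalIntegrable _ _
  have hrei : ∀ {a b : ℝ → E}, Continuous a → Continuous b →
      (∫ t in (0 : ℝ)..T, S.jumpForm T t (a t) (b t)).re
        = ∫ t in (0 : ℝ)..T, (S.jumpForm T t (a t) (b t)).re := fun ha hb =>
    (Complex.reCLM.intervalIntegral_comp_comm (hcont ha hb)).symm
  have himi : ∀ {a b : ℝ → E}, Continuous a → Continuous b →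
      (∫ t in (0 : ℝ)..T, S.jumpForm T t (a t) (b t)).im
        = ∫ t in (0 : ℝ)..T, (S.jumpForm T t (a t) (b t)).im := fun ha hb =>
    (Complex.imCLM.intervalIntegral_comp_comm (hcont ha hb)).symm
  -- The joint states are asymptotically normalized, …
  rw [norm_sq_add_integral_jumpForm h hT huc hu, hu0] at huu
  have hnorm : Tendsto (fun N => ‖S.jointVec T N ψ x‖ ^ 2) atTop (𝓝 1) := by
    have := (Complex.continuous_re.tendsto _).comp huu
    simpa only [Function.comp_def, re_inner_self, hψ, one_pow] using this
  have hdnorm : Tendsto (fun N => ‖D N‖ ^ 2) atTop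
      (𝓝 (‖v T‖ ^ 2 + ∫ t in (0 : ℝ)..T, (S.jumpForm T t (v t) (v t)).re)) := by
    have := (Complex.continuous_re.tendsto _).comp hvv
    simpa only [Function.comp_def, re_inner_self, Complex.add_re, hrei hvc hvc] using this
  -- … and their overlap with the derivative is asymptotically imaginary.
  have hcross : Tendsto (fun N => ‖inner ℂ (S.jointVec T N ψ x) (D N)‖ ^ 2) atTop
      (𝓝 (((inner ℂ (u T) (v T)).im
          + ∫ t in (0 : ℝ)..T, (S.jumpForm T t (u t) (v t)).im) ^ 2)) := by
    have := (huv.norm).pow 2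
    rwa [Complex.sq_norm, Complex.normSq_apply, Complex.add_re, Complex.add_im, hrei huc hvc,
      himi huc hvc, re_inner_add_integral_jumpForm h hT huc hvc hu hv0 hv, zero_mul, zero_add,
      ← sq] at this
  have hlimit := ((hdnorm.div hnorm one_ne_zero).sub
    (hcross.div (hnorm.pow 2) (pow_ne_zero 2 one_ne_zero))).const_mul 4
  simp only [one_pow, div_one] at hlimit
  refine hlimit.congr' ?_
  filter_upwards [hnorm.eventually_ne one_ne_zero] with N hN
  have h0 : S.jointVec T N ψ x ≠ 0 := fun h0 => hN (by simp [h0])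
  rw [collisionQFI, pureQFI_normalized (hasDerivAt_jointVec h hT N ψ x) h0]
  simp only [Pi.div_apply, ← pow_mul]
  rfl

theorem lossless_iff (h : S.Regular T) (hT : 0 < T) {ψ : E} (hψ : ‖ψ‖ = 1) (x : ℝ) :
    S.Lossless T ψ x ↔ HasDerivAt (fun y => S.prob T ψ y) 0 x ∧
      ∀ j, ∀ t ∈ Icc 0 T, 0 < S.γ j t → S.L j (S.xiTilde T ψ x t) = 0 := by
  obtain ⟨u, v, huc, hvc, hu0, hv0, hpsi, hdpsi, hu, hv, hθ⟩ := exists_state h hT x ψ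
  have hTm : T ∈ Icc 0 T := ⟨hT.le, le_rfl⟩
  have huT : u T ≠ 0 := fun h0 => by
    have := eq_zero_of_final_eq_zero h hT hu h0
    rw [hu0] at this
    simp [this] at hψ
  set p : ℝ := ‖u T‖ ^ 2 with hp
  have hp0 : 0 < p := by
    have := norm_pos_iff.2 huT
    positivity
  set r : ℝ := (inner ℂ (u T) (v T)).re with hr
  set b : ℝ := (inner ℂ (u T) (v T)).im with hb
  set W : ℝ := ∫ t in (0 : ℝ)..T, (S.jumpForm T t (u t) (v t)).im with hW
  set Δ : ℝ := ∫ t in (0 : ℝ)..T, (S.jumpForm T t (v t) (v t)).re with hΔ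
  have hc : ∀ {w z : ℝ → E}, Continuous w → Continuous z →
      Continuous fun t => S.jumpForm T t (w t) (z t) := fun hw hz =>
    h.continuous_jumpForm hT continuous_id hw hz
  have hre : ∀ {w : ℝ → E}, Continuous w →
      Continuous fun t => (S.jumpForm T t (w t) (w t)).re := fun hw =>
    Complex.continuous_re.comp (hc hw hw)
  have him : Continuous fun t => (S.jumpForm T t (u t) (v t)).im :=
    Complex.continuous_im.comp (hc huc hvc)
  have hP : ∫ t in (0 : ℝ)..T, (S.jumpForm T t (u t) (u t)).re = 1 - p := by
    have h1 := congrArg Complex.re (norm_sq_add_integral_jumpForm h hT huc hu)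
    have h2 : (∫ t in (0 : ℝ)..T, S.jumpForm T t (u t) (u t)).re
        = ∫ t in (0 : ℝ)..T, (S.jumpForm T t (u t) (u t)).re :=
      (Complex.reCLM.intervalIntegral_comp_comm ((hc huc huc).intervalIntegrable _ _)).symm
    rw [Complex.add_re, h2, re_inner_self, re_inner_self, hu0, hψ] at h1
    linarith
  -- The integrated jump intensity of `v + i s u`.
  have hq : ∀ s : ℝ, ∫ t in (0 : ℝ)..T, (S.jumpForm T t (v t + (Complex.I * (s : ℂ)) • u t)
      (v t + (Complex.I * (s : ℂ)) • u t)).re = Δ + 2 * s * W + s ^ 2 * (1 - p) := fun s => by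
    simp only [jumpForm_self_add_smul]
    rw [intervalIntegral.integral_add, intervalIntegral.integral_add,
      intervalIntegral.integral_const_mul, intervalIntegral.integral_const_mul, hP]
    · exact (hre hvc).intervalIntegrable _ _
    · exact (him.const_mul _).intervalIntegrable _ _
    · exact ((hre hvc).add (him.const_mul _)).intervalIntegrable _ _
    · exact ((hre huc).const_mul _).intervalIntegrable _ _
  have hq0 : ∀ s : ℝ, 0 ≤ Δ + 2 * s * W + s ^ 2 * (1 - p) := fun s => by
    rw [← hq s]
    exact integral_nonneg hT.le fun t _ => jumpForm_self_nonneg h hT t _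
  have hpost : S.postselectedQFI T ψ x = 4 * (‖v T‖ ^ 2 - (r ^ 2 + b ^ 2) / p) := by
    have hne : S.psiTilde T ψ x ≠ 0 := by rwa [hpsi T hTm]
    rw [postselectedQFI, pureQFI_normalized (hdpsi T hTm) hne, prob_eq_norm_sq, hpsi T hTm,
      Complex.sq_norm, Complex.normSq_apply, ← hr, ← hb, hp]
    have := norm_ne_zero_iff.2 huT
    field_simp
  have hloss : S.Lossless T ψ x ↔ Δ - (b + W) ^ 2 + (r ^ 2 + b ^ 2) / p = 0 := by
    have hlim := tendsto_collisionQFI h hT hψ huc hvc hu0 hu hv0 hv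
    rw [Lossless, hpost]
    constructor
    · intro hl
      have := tendsto_nhds_unique hl hlim
      linarith
    · intro h0
      convert hlim using 2
      linarith
  have hprob : HasDerivAt (fun y => S.prob T ψ y) 0 x ↔ r = 0 := by
    have hd : HasDerivAt (fun y => S.prob T ψ y) (2 * r) x := by
      have hd := Complex.reCLM.hasFDerivAt.comp_hasDerivAt x
        ((hdpsi T hTm).inner ℂ (hdpsi T hTm))
      rw [hpsi T hTm] at hd
      refine (hd.congr_deriv ?_).congr_of_eventuallyEq (Eventually.of_forall fun y => ?_)
      · rw [Complex.reCLM_apply, Complex.add_re, ← inner_conj_symm (v T), Complex.conj_re, hr]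
        ring
      · simp only [prob_eq_norm_sq, Function.comp_apply, Complex.reCLM_apply, re_inner_self]
    constructor
    · intro h0
      have := hd.unique h0
      linarith
    · intro h0
      simpa [h0] using hd
  have hxi : ∀ t ∈ Icc 0 T,
      S.xiTilde T ψ x t = v t + (Complex.I * ((-b / p : ℝ) : ℂ)) • u t := fun t ht => by
    rw [xiTilde, (hdpsi t ht).deriv, hpsi t ht, hθ]
  have hwc : Continuous fun t => v t + (Complex.I * ((-b / p : ℝ) : ℂ)) • u t :=
    hvc.add (huc.const_smul _)
  rw [hloss, hprob, fisher_gap_eq_zero_iff hp0 hq0, ← hq,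
    integral_jumpForm_self_eq_zero_iff h hT hwc]
  refine and_congr_right fun _ => forall_congr' fun j => forall₂_congr fun t ht => ?_
  rw [hxi t ht]

theorem Regular.continuousOn_xiTilde (h : S.Regular T) (hT : 0 < T) (ψ : E) (x : ℝ) :
    ContinuousOn (S.xiTilde T ψ x) (Icc 0 T) := by
  obtain ⟨u, v, huc, hvc, -, -, hpsi, hdpsi, -⟩ := exists_state h hT x ψ
  have hwc : Continuous fun t => v t + (Complex.I * (S.dTheta T ψ x : ℂ)) • u t :=
    hvc.add (huc.const_smul _)
  refine hwc.continuousOn.congr fun t ht => ?_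
  rw [xiTilde, (hdpsi t ht).deriv, hpsi t ht]

end Model

end NHSensing

theorem theorem2 {E : Type*} [NormedAddCommGroup E] [InnerProductSpace ℂ E] [CompleteSpace E]
    {J : Type*} [Fintype J] (S : NHSensing.Model E J) (T : ℝ) (hT : 0 < T)
    (hH₀_sa : ∀ x : ℝ, ∀ t ∈ Set.Icc 0 T, IsSelfAdjoint (S.H₀ x t))
    (hH₁_sa : ∀ t ∈ Set.Icc 0 T, IsSelfAdjoint (S.H₁ t))
    (hγ_nonneg : ∀ j, ∀ t ∈ Set.Icc 0 T, 0 ≤ S.γ j t)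
    (hH₀_cont : ContinuousOn (fun p : ℝ × ℝ => S.H₀ p.1 p.2) (Set.univ ×ˢ Set.Icc 0 T))
    (hH₀_diff : ∀ t ∈ Set.Icc 0 T, Differentiable ℝ (fun x => S.H₀ x t))
    (hH₀_deriv_cont : ContinuousOn (fun p : ℝ × ℝ => deriv (fun x => S.H₀ x p.2) p.1)
      (Set.univ ×ˢ Set.Icc 0 T))
    (hH₁_cont : ContinuousOn S.H₁ (Set.Icc 0 T))
    (hγ_cont : ∀ j, ContinuousOn (S.γ j) (Set.Icc 0 T))
    (ψ : E) (hψ : ‖ψ‖ = 1) (x : ℝ) :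
    (S.Lossless T ψ x ↔
      HasDerivAt (fun y => S.prob T ψ y) 0 x ∧
        ∀ j, ∀ t ∈ Set.Icc 0 T, 0 < S.γ j t → S.L j (S.xiTilde T ψ x t) = 0) ∧
    ((∀ j, Set.Icc 0 T ⊆ closure {t | t ∈ Set.Icc 0 T ∧ 0 < S.γ j t}) →
      (S.Lossless T ψ x ↔
        HasDerivAt (fun y => S.prob T ψ y) 0 x ∧
          ∀ j, ∀ t ∈ Set.Icc 0 T, S.L j (S.xiTilde T ψ x t) = 0)) := by
  have h : S.Regular T := ⟨hH₀_sa, hH₁_sa, hγ_nonneg, hH₀_cont, hH₀_diff, hH₀_deriv_cont,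
    hH₁_cont, hγ_cont⟩
  have hiff := NHSensing.Model.lossless_iff h hT hψ x
  refine ⟨hiff, fun hdense => hiff.trans (and_congr_right fun _ => forall_congr' fun j => ?_)⟩
  refine ⟨fun h0 t ht => ?_, fun h0 t ht _ => h0 t ht⟩
  -- `L j ξ̃` is continuous on `[0, T]` and vanishes on a dense subset.
  have hcont : ContinuousOn (fun t => S.L j (S.xiTilde T ψ x t)) (Set.Icc 0 T) :=
    (S.L j).continuous.comp_continuousOn (h.continuousOn_xiTilde hT ψ x)
  have hsub : {t | t ∈ Set.Icc 0 T ∧ 0 < S.γ j t} ⊆ Set.Icc 0 T := fun t ht => ht.1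
  have heq : Set.EqOn (fun t => S.L j (S.xiTilde T ψ x t)) (fun _ => 0)
      {t | t ∈ Set.Icc 0 T ∧ 0 < S.γ j t} := fun t ht => h0 t ht.1 ht.2
  exact heq.of_subset_closure hcont continuousOn_const hsub (hdense j) ht
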